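/- **Setting.** A causal graph $G$ is a finite DAG. A causal Bayesian network with graph $G$ assigns to each variable a finite nonempty set of states and to each variable $n$ with parents $\mathbf P_n$ a CPT $f_n(n\mid \mathbf P_n)\ge 0$ with $\sum_{s} f_n(s\mid\mathbf p)=1$; it induces $\Pr=\prod_n f_n$. The interventional distribution $\Pr_{\mathbf x}$ is the one induced by the mutilated network: edges into $\mathbf X$ are removed and the CPT of each $X\in\mathbf X$ is replaced by the point mass at its state in $\mathbf x$. A variable is functional in a network if its CPT takes only the values $0$ and $1$. Let $\mathbf V$ be a set of (observed) variables of $G$, $\mathcal C_{\mathbf V}$ a set of positivity constraints $\Pr(\mathbf S\mid\mathbf Z)>0$ with disjoint $\mathbf S,\mathbf Z\subseteq\mathbf V$ (meaning: $\Pr(\mathbf z)>0$ implies $\Pr(\mathbf s,\mathbf z)>0$ for all $\mathbf s,\mathbf z$), and $\mathbf W$ a set of variables of $G$. The causal effect of $\mathbf X$ on $\mathbf Y$ is *F-identifiable* with respect to $\langle G,\mathbf V,\mathcal C_{\mathbf V},\mathbf W\rangle$ if $\Pr^1_{\mathbf x}(\mathbf y)=\Pr^2_{\mathbf x}(\mathbf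 y)$ for all $\mathbf x,\mathbf y$ and for every pair of networks with graph $G$ (over the same, arbitrary, finite state spaces) whose distributions satisfy $\Pr^1(\mathbf V)=\Pr^2(\mathbf V)$ and $\mathcal C_{\mathbf V}$, and in which all variables of $\mathbf W$ are functional. It is *identifiable* with respect to $\langle G,\mathbf V,\mathcal C_{\mathbf V}\rangle$ if the same holds without the requirement on $\mathbf W$. *Functional elimination* of a variable $T$ from a DAG adds an edge from each parent of $T$ to each child of $T$ and then removes $T$; a set of variables is eliminated one variable after the other (the order is irrelevant). The *projection* of a DAG $G$ on $\mathbf V$ has the variables $\mathbf V$, an edge $A\to B$ for $A,B\in\mathbf V$ whenever $G$ has a directed path from $A$ to $B$ with no internal node in $\mathbf V$ (a single edge included), and, for every two distinct $A,B\in\mathbf V$ joined in $G$ by a divergent path $A\leftarrow\cdots\leftarrow U\to\cdots\to B$ with no internal node in $\mathbf V$, one auxiliary hidden root $H_{AB}$ with edges $A\leftarrow H_{AB}\to B$. If $\mathbf W\cap\mathbf V=\emptyset$, the *functional projection* of $G$ on $\mathbf V$ is obtained by functionally eliminating $\mathbf W$ from $G$ and then projecting the result on $\mathbf V$. **Corollary.**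 Let $G$ be a causal graph with observed variables $\mathbf V$, let $\mathbf W$ be a set of functional variables of $G$ that are all hidden ($\mathbf W\cap\mathbf V=\emptyset$), let $\mathcal C_{\mathbf V}=\{\Pr(\mathbf V)>0\}$, and let $\mathbf X,\mathbf Y\subseteq\mathbf V$. If $G'$ is the functional projection of $G$ on $\mathbf V$, then the causal effect of $\mathbf X$ on $\mathbf Y$ is F-identifiable with respect to $\langle G,\mathbf V,\mathcal C_{\mathbf V},\mathbf W\rangle$ if and only if it is identifiable with respect to $\langle G',\mathbf V,\mathcal C_{\mathbf V}\rangle$. -/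

import Mathlib

universe u

namespace CausalID

/-- A causal graph: a directed acyclic graph on a finite set `verts` of variables,
whose names are taken from the type `N`. -/
@[ext]
structure CausalGraph (N : Type u) extends Digraph N where
  verts : Finset N
  left_mem : ∀ {a b : N}, Adj a b → a ∈ verts
  right_mem : ∀ {a b : N}, Adj a b → b ∈ verts
  acyclic : ∀ a : N, ¬ Relation.TransGen Adj a a

namespace CausalGraph

variable {N : Type u} [DecidableEq N]

/-- The (subtype of) parents of a variable. -/
abbrev Parents (G : CausalGraph N) (n : N) : Type u := {p : N // G.Adj p n}

/-- Instantiations of all the variables of `G`, where variable `n` has the states `S n`. -/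
abbrev Inst (G : CausalGraph N) (S : N → Type u) : Type u := ∀ n : G.verts, S n

/-- The instantiation of the parents of `n` that `z` contains. -/
def parentInst (G : CausalGraph N) {S : N → Type u} (z : G.Inst S) (n : N) :
    ∀ p : G.Parents n, S p :=
  fun p => z ⟨p.1, G.left_mem p.2⟩

/-- The graph without the edges that point to variables in `X`. -/
abbrev mutilate (G : CausalGraph N) (X : Finset N) : CausalGraph N where
  Adj a b := G.Adj a b ∧ b ∉ X
  verts := G.verts
  left_mem h := G.left_mem h.1
  right_mem h := G.right_mem h.1
  acyclic a h := G.acyclic a (Relation.TransGen.mono (fun _ _ h => h.1) _ _ h)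

/-- Functional elimination of one variable `x`: add an edge from each parent of `x` to each
child of `x`, then remove `x`. -/
def elim (G : CausalGraph N) (x : N) : CausalGraph N where
  Adj a b := a ≠ x ∧ b ≠ x ∧ (G.Adj a b ∨ (G.Adj a x ∧ G.Adj x b))
  verts := G.verts.erase x
  left_mem := by
    rintro a b ⟨ha, -, h | h⟩
    · exact Finset.mem_erase.2 ⟨ha, G.left_mem h⟩
    · exact Finset.mem_erase.2 ⟨ha, G.left_mem h.1⟩
  right_mem := by
    rintro a b ⟨-, hb, h | h⟩
    · exact Finset.mem_erase.2 ⟨hb, G.right_mem h⟩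
    · exact Finset.mem_erase.2 ⟨hb, G.right_mem h.2⟩
  acyclic := by
    intro a h
    refine G.acyclic a (Relation.TransGen.trans_induction_on
      (motive := fun {a b} _ => Relation.TransGen G.Adj a b) h ?_ ?_)
    · rintro a b ⟨-, -, h | h⟩
      · exact .single h
      · exact .tail (.single h.1) h.2
    · intro a b c _ _ h₁ h₂
      exact h₁.trans h₂

/-- The order of functional elimination does not matter. -/
instance elim_rightCommutative :
    RightCommutative (elim : CausalGraph N → N → CausalGraph N) where
  right_comm G x y := by
    ext a b
    · simp only [elim]
      by_cases hxy : x = y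
      · subst hxy; tauto
      · have hyx : y ≠ x := fun h => hxy h.symm
        tauto
    · simp only [elim, Finset.mem_erase]
      tauto

/-- Functional elimination of the variables in `W`, one after the other. -/
def elimSet (G : CausalGraph N) (W : Finset N) : CausalGraph N :=
  W.val.foldl elim G

/-- There is a directed path (with at least one edge) from `a` to `b` in `G`
with no internal node in `V`. -/
inductive HiddenPath (G : CausalGraph N) (V : Finset N) : N → N → Prop
  | edge {a b : N} : G.Adj a b → HiddenPath G V a b
  | cons {a c b : N} : G.Adj a c → c ∉ V → HiddenPath G V c b → HiddenPath G V a b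

open Classical in
/-- The bidirected edges of the projection on `V`: the unordered pairs of distinct variables
of `V` that are joined by a divergent path `a ← ⋯ ← h → ⋯ → b` with no internal node in `V`. -/
noncomputable def bidirected (G : CausalGraph N) (V : Finset N) : Finset (Sym2 N) :=
  V.sym2.filter fun e => ¬ e.IsDiag ∧ ∃ h, h ∉ V ∧ ∀ a ∈ e, G.HiddenPath V h a

theorem mem_of_mem_bidirected {G : CausalGraph N} {V : Finset N} {e : Sym2 N} {a : N}
    (he : e ∈ G.bidirected V) (ha : a ∈ e) : a ∈ V := by
  classical
  unfold bidirected at he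
  exact Finset.mem_sym2_iff.1 (Finset.mem_filter.1 he).1 a ha

theorem HiddenPath.transGen {N : Type u} {G : CausalGraph N} {V : Finset N} {a b : N}
    (h : G.HiddenPath V a b) : Relation.TransGen G.Adj a b := by
  induction h with
  | edge h => exact .single h
  | cons h _ _ ih => exact .head h ih

/-- The edges of the projection on `V`, where the auxiliary hidden variable of the bidirected
edge `e` is `inr e`. -/
def ProjectAdj (G : CausalGraph N) (V : Finset N) : N ⊕ Sym2 N → N ⊕ Sym2 N → Prop
  | .inl a, .inl b => a ∈ V ∧ b ∈ V ∧ G.HiddenPath V a b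
  | .inr e, .inl b => e ∈ G.bidirected V ∧ b ∈ e
  | .inl _, .inr _ => False
  | .inr _, .inr _ => False

/-- Projection of `G` on `V`. Its variables are those of `V` (tagged `inl`) and one auxiliary
hidden root (tagged `inr`) for each bidirected edge, with the two ends of the edge as its
children. -/
noncomputable def project (G : CausalGraph N) (V : Finset N) : CausalGraph (N ⊕ Sym2 N) where
  Adj := G.ProjectAdj V
  verts := V.disjSum (G.bidirected V)
  left_mem := by
    rintro (a | e) (b | e') h
    · exact Finset.inl_mem_disjSum.2 h.1
    · exact h.elim
    · exact Finset.inr_mem_disjSum.2 h.1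
    · exact h.elim
  right_mem := by
    rintro (a | e) (b | e') h
    · exact Finset.inl_mem_disjSum.2 h.2.1
    · exact h.elim
    · exact Finset.inl_mem_disjSum.2 (mem_of_mem_bidirected h.1 h.2)
    · exact h.elim
  acyclic := by
    rintro (a | e) h
    · have key : ∀ m : N ⊕ Sym2 N, Relation.TransGen (G.ProjectAdj V) (Sum.inl a) m →
          ∃ b, m = Sum.inl b ∧ Relation.TransGen G.Adj a b := by
        intro m hm
        induction hm with
        | @single m h =>
          rcases m with b | e
          · exact ⟨b, rfl, h.2.2.transGen⟩
          · exact h.elim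
        | @tail m m' _ h ih =>
          obtain ⟨b, rfl, hb⟩ := ih
          rcases m' with c | e
          · exact ⟨c, rfl, hb.trans h.2.2.transGen⟩
          · exact h.elim
      obtain ⟨b, hb, hab⟩ := key _ h
      cases hb
      exact G.acyclic a hab
    · cases h with
      | single h => exact h.elim
      | @tail b _ _ h => cases b <;> exact h.elim

/-- Functional projection of `G` on `V`, where `W` are the hidden functional variables:
functionally eliminate `W`, then project on `V`. -/
noncomputable def functionalProjection (G : CausalGraph N) (V W : Finset N) :
    CausalGraph (N ⊕ Sym2 N) :=
  (G.elimSet W).project V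

end CausalGraph

section Models

variable {N : Type u} [DecidableEq N]

/-- The parameters (CPTs) of a causal Bayesian network with causal graph `G`, in which
variable `n` has the states `S n`: `cpt n s pa` is the probability of the state `s` of `n`
given the instantiation `pa` of its parents. -/
structure BN (G : CausalGraph N) (S : N → Type u) [∀ n, Fintype (S n)] where
  cpt : ∀ n : G.verts, S n → (∀ p : G.Parents n, S p) → ℝ
  cpt_nonneg : ∀ n s pa, 0 ≤ cpt n s pa
  cpt_sum : ∀ n pa, ∑ s, cpt n s pa = 1

/-- A positivity constraint `Pr(S | Z) > 0` on the distribution of the variables `V`. -/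
structure PositivityConstraint (V : Finset N) where
  S : Finset N
  Z : Finset N
  S_subset : S ⊆ V
  Z_subset : Z ⊆ V
  disjoint : Disjoint S Z

/-- Strict positivity `Pr(V) > 0`. -/
def strictPositivity (V : Finset N) : PositivityConstraint V where
  S := V
  Z := ∅
  S_subset := Finset.Subset.refl V
  Z_subset := Finset.empty_subset V
  disjoint := Finset.disjoint_empty_right V

namespace BN

variable {G : CausalGraph N} {S : N → Type u} [∀ n, Fintype (S n)]

/-- The joint distribution: the product of the CPTs. -/
def joint (M : BN G S) (z : G.Inst S) : ℝ :=
  ∏ n : G.verts, M.cpt n (z n) (G.parentInst z n)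

open Classical in
/-- The marginal probability `Pr(a)`, where `a` is the instantiation of the variables `A`
that is contained in the instantiation `w`. (Only the states that `w` gives to variables
in `A` matter.) -/
noncomputable def prob (M : BN G S) (A : Finset N) (w : G.Inst S) : ℝ :=
  ∑ z : G.Inst S, if ∀ n : G.verts, (n : N) ∈ A → z n = w n then M.joint z else 0

open Classical in
/-- The mutilated network under the treatment `do(x)`, where `x` is read as an instantiation
of the variables in `X` only. -/
noncomputable def mutilate (M : BN G S) (X : Finset N) (x : G.Inst S) :
    BN (G.mutilate X) S where
  cpt n s pa :=
    if h : (n : N) ∈ X then (if s = x n then 1 else 0)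
    else M.cpt n s (fun p => pa ⟨p.1, p.2, h⟩)
  cpt_nonneg n s pa := by
    split_ifs
    · exact zero_le_one
    · exact le_refl 0
    · exact M.cpt_nonneg _ _ _
  cpt_sum n pa := by
    by_cases h : (n : N) ∈ X
    · simp [h]
    · simp only [h, dif_neg, not_false_eq_true]
      exact M.cpt_sum n _

/-- The causal effect `Pr_x(y)`. -/
noncomputable def effect (M : BN G S) (X : Finset N) (x : G.Inst S)
    (Y : Finset N) (y : G.Inst S) : ℝ :=
  (M.mutilate X x).prob Y y

/-- The distribution of the network satisfies the positivity constraint `Pr(S | Z) > 0`. -/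
def Satisfies (M : BN G S) {V : Finset N} (c : PositivityConstraint V) : Prop :=
  ∀ w : G.Inst S, 0 < M.prob c.Z w → 0 < M.prob (c.S ∪ c.Z) w

/-- The variables in `W` functionally depend on their parents. -/
def Functional (M : BN G S) (W : Finset N) : Prop :=
  ∀ n : G.verts, (n : N) ∈ W → ∀ s pa, M.cpt n s pa = 0 ∨ M.cpt n s pa = 1

end BN

/-- The causal effect of `X` on `Y` is identifiable with respect to `⟨G, V, C⟩`: for all
finite state spaces, any two networks with causal graph `G` that satisfy the constraints `C`
and have the same distribution over the observed variables `V` have the same causal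
effect. -/
def Identifiable (G : CausalGraph N) (V : Finset N) (C : Set (PositivityConstraint V))
    (X Y : Finset N) : Prop :=
  ∀ (S : N → Type u) [∀ n, Fintype (S n)] [∀ n, Nonempty (S n)] (M₁ M₂ : BN G S),
    (∀ v, M₁.prob V v = M₂.prob V v) →
    (∀ c ∈ C, M₁.Satisfies c) → (∀ c ∈ C, M₂.Satisfies c) →
    ∀ x y, M₁.effect X x Y y = M₂.effect X x Y y

/-- The causal effect of `X` on `Y` is F-identifiable with respect to `⟨G, V, C, W⟩`: as
`Identifiable`, but only networks are considered in which the variables in `W` functionally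
depend on their parents. -/
def FIdentifiable (G : CausalGraph N) (V : Finset N) (C : Set (PositivityConstraint V))
    (W X Y : Finset N) : Prop :=
  ∀ (S : N → Type u) [∀ n, Fintype (S n)] [∀ n, Nonempty (S n)] (M₁ M₂ : BN G S),
    (∀ v, M₁.prob V v = M₂.prob V v) →
    (∀ c ∈ C, M₁.Satisfies c) → (∀ c ∈ C, M₂.Satisfies c) →
    M₁.Functional W → M₂.Functional W →
    ∀ x y, M₁.effect X x Y y = M₂.effect X x Y y

end Models

/-- The variables of `V`, as variables of a projection. -/
def observed {N : Type u} (V : Finset N) : Finset (N ⊕ Sym2 N) :=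
  V.map Function.Embedding.inl

end CausalID

/-! For `C ⊆ V` let Q[C] (`BN.kernel`) be the sum over the hidden variables of the product of the
CPTs of all hidden variables and of `C`, as a function of the observed states. Then `Pr(V)` is Q[V],
and the effect of `X` on `Y` is a marginal of Q[A] for any `A ⊆ V \ X` that contains `Y \ X` and is
ancestral in `V \ X` (`BN.effect_eq_marg_kernel`). Kernels obey two rules. Summing out the
complement of an ancestral subset of `C` gives the kernel of that subset
(`BN.marg_kernel_of_ancestral`). Moreover Q[C₁ ∪ C₂] = Q[C₁] Q[C₂] if every hidden variable that
reaches both sides by hidden paths is in `W` (`BN.kernel_union`): with the observed states fixed,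
the CPTs of these shared functional variables multiply to a point mass, and a point mass integrates
products to products. Hence only hidden sources outside `W` create bidirected edges. These are the
bidirected edges of the functional projection, because eliminating `W` preserves hidden paths
(`hiddenPath_elimSet`).

From identifiable to F-identifiable, the link is the hedge. If there is none, the two rules,
together with division by positive kernels, determine the effect from Q[V]
(`BN.effect_eq_of_no_hedge`). If there is one, identifiability in the projection fails
(`not_identifiable_of_isHedge`). The two witnessing networks have sign-valued variables and are
analysed by Fourier expansion. In both, the only observable trace of the hidden signs is the same
correlation of the product of the first signs over `D`. In one network it comes from all of `F` and
is destroyed by `do(X)`, since `F` meets `X`; in the other it comes from `D` alone and survives. The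
second signs carry it to `Y`.

From F-identifiable to identifiable, every network on the projection is simulated by one on `G` in
which `W` is functional, with the same distribution of `V` and the same effects
(`RelayPlan.effect_simBN`). The auxiliary variable of a bidirected edge is generated at a hidden
source outside `W`, and all other hidden variables merely copy values along hidden paths. -/

namespace CausalID

/-! ### Partial sums of functions on finite products. -/

section Marginalization

variable {ι : Type*} [Fintype ι] [DecidableEq ι] {S : ι → Type*} [∀ i, Fintype (S i)]

open Classical in
/-- The sum of `F` over the variables in `A`, the others being fixed as in `v`. -/
noncomputable def marg (A : Finset ι) (F : (∀ i, S i) → ℝ) (v : ∀ i, S i) : ℝ :=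
  ∑ z : ∀ i, S i, if ∀ i, i ∉ A → z i = v i then F z else 0

theorem marg_empty (F : (∀ i, S i) → ℝ) : marg ∅ F = F := by
  classical
  funext v
  unfold marg
  rw [Finset.sum_eq_single v]
  · simp
  · intro z _ hz
    rw [if_neg]
    intro h
    exact hz (funext fun i => h i (Finset.notMem_empty i))
  · simp

theorem marg_marg {A B C : Finset ι} (hAB : Disjoint A B) (hC : C = A ∪ B)
    (F : (∀ i, S i) → ℝ) : marg A (marg B F) = marg C F := by
  classical
  subst hC
  funext v
  unfold marg
  have : ∀ y : ∀ i, S i, (if ∀ i, i ∉ A → y i = v i then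
      ∑ z : ∀ i, S i, if ∀ i, i ∉ B → z i = y i then F z else 0 else 0) =
      ∑ z : ∀ i, S i, if (∀ i, i ∉ A → y i = v i) ∧ (∀ i, i ∉ B → z i = y i) then F z else 0 := by
    intro y
    by_cases h : ∀ i, i ∉ A → y i = v i
    · rw [if_pos h]
      exact Finset.sum_congr rfl fun z _ => if_congr (and_iff_right h).symm rfl rfl
    · rw [if_neg h, eq_comm]
      exact Finset.sum_eq_zero fun z _ => if_neg fun hh => h hh.1
  simp only [this]
  rw [Finset.sum_comm]
  refine Finset.sum_congr rfl fun z _ => ?_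
  -- For fixed `z` the intermediate point is forced: it equals `v` off `A`, and `z` on `A`, which is
  -- disjoint from `B`.
  rw [Finset.sum_eq_single (fun i => if i ∈ A then z i else v i)]
  · refine if_congr ?_ rfl rfl
    constructor
    · rintro ⟨_, h⟩ i hi
      have := h i (fun hB => hi (Finset.mem_union_right _ hB))
      simpa [show i ∉ A from fun hA => hi (Finset.mem_union_left _ hA)] using this
    · intro h
      refine ⟨fun i hi => by simp [hi], fun i hi => ?_⟩
      by_cases hA : i ∈ A
      · simp [hA]
      · simp [hA, h i (by simp [hA, hi])]
  · intro y _ hy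
    rw [if_neg]
    rintro ⟨h1, h2⟩
    apply hy
    funext i
    by_cases hA : i ∈ A
    · simp [hA, h2 i (Finset.disjoint_left.1 hAB hA)]
    · simp [hA, h1 i hA]
  · simp

theorem marg_mul_left {A : Finset ι} {g F : (∀ i, S i) → ℝ}
    (hg : ∀ z z' : ∀ i, S i, (∀ i, i ∉ A → z i = z' i) → g z = g z') (v : ∀ i, S i) :
    marg A (fun z => g z * F z) v = g v * marg A F v := by
  classical
  unfold marg
  rw [Finset.mul_sum]
  refine Finset.sum_congr rfl fun z _ => ?_
  split_ifs with h
  · show g z * F z = g v * F z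
    rw [hg z v h]
  · simp

theorem marg_singleton (n : ι) (F : (∀ i, S i) → ℝ) (v : ∀ i, S i) :
    marg {n} F v = ∑ s, F (Function.update v n s) := by
  classical
  unfold marg
  symm
  refine Fintype.sum_of_injective (fun s => Function.update v n s)
    (Function.update_injective v n) _ _ ?_ ?_
  · intro z hz
    rw [if_neg]
    intro h
    apply hz
    refine ⟨z n, funext fun i => ?_⟩
    by_cases hi : i = n
    · subst hi; simp
    · simp [hi, h i (by simpa using hi)]
  · intro s
    rw [if_pos]
    intro i hi
    exact Function.update_of_ne (by simpa using hi) _ _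

/-- If a product distribution over `A` takes only the values `0` and `1`, it is a point mass. -/
theorem marg_mul_of_zero_or_one {A : Finset ι} {F : (∀ i, S i) → ℝ} {v : ∀ i, S i}
    (hF : ∀ z, F z = 0 ∨ F z = 1) (h1 : marg A F v = 1) :
    ∃ z₀ : ∀ i, S i, ∀ g : (∀ i, S i) → ℝ, marg A (fun z => F z * g z) v = g z₀ := by
  classical
  set T : Finset (∀ i, S i) :=
    Finset.univ.filter (fun z => (∀ i, i ∉ A → z i = v i) ∧ F z = 1) with hT
  have key : ∀ g : (∀ i, S i) → ℝ, marg A (fun z => F z * g z) v = ∑ z ∈ T, g z := by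
    intro g
    unfold marg
    rw [hT, Finset.sum_filter]
    refine Finset.sum_congr rfl fun z _ => ?_
    rcases hF z with h | h <;> simp [h]
  have hcard : (T.card : ℝ) = 1 := by
    have h2 := key (fun _ => 1)
    simp only [mul_one] at h2
    rw [← h1, h2, Finset.sum_const, nsmul_eq_mul, mul_one]
  obtain ⟨z₀, hz₀⟩ := Finset.card_eq_one.1 (by exact_mod_cast hcard : T.card = 1)
  exact ⟨z₀, fun g => by rw [key, hz₀, Finset.sum_singleton]⟩

/-- Summing out the variables of `K` that are not in the ancestral subset `K'`. -/
theorem marg_prod_of_ancestral {adj : ι → ι → Prop} (hac : ∀ a, ¬ Relation.TransGen adj a a)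
    {f : ι → (∀ i, S i) → ℝ}
    (hdep : ∀ n (z z' : ∀ i, S i), z n = z' n → (∀ p, adj p n → z p = z' p) → f n z = f n z')
    (hsum : ∀ n (z : ∀ i, S i), ∑ s, f n (Function.update z n s) = 1)
    {K K' A : Finset ι} (hK : K' ⊆ K) (hA : A = K \ K')
    (hanc : ∀ n ∈ K', ∀ p ∈ K, adj p n → p ∈ K') :
    marg A (fun z => ∏ n ∈ K, f n z) = fun z => ∏ n ∈ K', f n z := by
  classical
  induction hk : A.card generalizing K A with
  | zero =>
    have hA0 : A = ∅ := Finset.card_eq_zero.1 hk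
    have : K = K' := by
      rw [hA0] at hA
      exact Finset.Subset.antisymm (Finset.sdiff_eq_empty_iff_subset.1 hA.symm) hK
    rw [hA0, marg_empty, this]
  | succ k ih =>
    have hne : A.Nonempty := Finset.card_pos.1 (by omega)
    -- A variable of `A` without children in `A` has none in `K`, as `K'` is closed under parents in
    -- `K`. Only its own factor depends on it, and that factor sums to 1.
    obtain ⟨n, hnA, hn⟩ : ∃ n ∈ A, ∀ m ∈ A, ¬ adj n m := by
      have : IsTrans ι (Relation.TransGen (Function.swap adj)) := inferInstance
      have : Std.Irrefl (Relation.TransGen (Function.swap adj)) :=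
        ⟨fun a h => hac a (Relation.transGen_swap.1 h)⟩
      have hwf : WellFounded (Relation.TransGen (Function.swap adj)) :=
        Finite.wellFounded_of_trans_of_irrefl _
      obtain ⟨n, hnA, hn⟩ := hwf.has_min (A : Set ι) hne
      exact ⟨n, hnA, fun m hm h => hn m hm (.single h)⟩
    have hnK : n ∈ K ∧ n ∉ K' := by simpa [hA] using hnA
    have hnc : ∀ m ∈ K, ¬ adj n m := by
      intro m hm h
      by_cases hm' : m ∈ K'
      · exact hnK.2 (hanc m hm' n hnK.1 h)
      · exact hn m (by simp [hA, hm, hm']) h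
    rw [← marg_marg (A := A.erase n) (B := {n}) (by simp) (by
      ext i; by_cases hi : i = n <;> simp [hi, hnA])]
    have h2 : marg {n} (fun z => ∏ i ∈ K, f i z) = fun z => ∏ i ∈ K.erase n, f i z := by
      funext v
      have : (fun z => ∏ i ∈ K, f i z) = fun z => (∏ i ∈ K.erase n, f i z) * f n z := by
        funext z
        rw [mul_comm, Finset.mul_prod_erase K (fun i => f i z) hnK.1]
      rw [this, marg_mul_left, marg_singleton, hsum, mul_one]
      intro z z' h
      refine Finset.prod_congr rfl fun i hi => ?_
      have hi' := Finset.mem_erase.1 hi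
      refine hdep i z z' (h i (by simpa using hi'.1)) fun p hp => h p ?_
      simp only [Finset.mem_singleton]
      rintro rfl
      exact hnc i hi'.2 hp
    rw [h2]
    refine ih (K := K.erase n) (fun i hi => Finset.mem_erase.2 ⟨?_, hK hi⟩) ?_ ?_ ?_
    · rintro rfl; exact hnK.2 hi
    · rw [hA]; ext i; simp; tauto
    · exact fun m hm p hp => hanc m hm p (Finset.mem_of_mem_erase hp)
    · rw [Finset.card_erase_of_mem hnA]; omega

end Marginalization

/-! ### Networks as products of factors; truncated products for interventions. -/

section Factors

variable {N : Type u} [DecidableEq N]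

namespace BN

variable {G : CausalGraph N} {S : N → Type u} [∀ n, Fintype (S n)]

/-- The CPT of `n`, as a function of an instantiation of all the variables. -/
def factor (M : BN G S) (n : G.verts) (z : G.Inst S) : ℝ :=
  M.cpt n (z n) (G.parentInst z n)

theorem factor_congr (M : BN G S) (n : G.verts) (z z' : G.Inst S) (hn : z n = z' n)
    (hp : ∀ p : G.verts, G.Adj p n → z p = z' p) : M.factor n z = M.factor n z' := by
  unfold factor
  rw [hn]
  congr 1
  funext p
  exact hp ⟨p.1, _⟩ p.2

theorem factor_nonneg (M : BN G S) (n : G.verts) (z : G.Inst S) : 0 ≤ M.factor n z :=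
  M.cpt_nonneg _ _ _

theorem sum_factor_update (M : BN G S) (n : G.verts) (z : G.Inst S) :
    ∑ s, M.factor n (Function.update z n s) = 1 := by
  rw [← M.cpt_sum n (G.parentInst z n)]
  refine Finset.sum_congr rfl fun s _ => ?_
  unfold factor
  rw [Function.update_self]
  congr 1
  funext p
  refine Function.update_of_ne ?_ _ _
  intro h
  have h2 : p.1 = n := congrArg Subtype.val h
  have h3 := p.2
  rw [h2] at h3
  exact G.acyclic n (.single h3)

theorem adj_verts_acyclic (G : CausalGraph N) (a : G.verts) :
    ¬ Relation.TransGen (fun p n : G.verts => G.Adj p n) a a := by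
  intro h
  exact G.acyclic a (Relation.TransGen.lift (fun n : G.verts => (n : N)) (fun _ _ h => h) _ _ h)

theorem marg_prod_factor (M : BN G S) {K K' A : Finset G.verts} (hK : K' ⊆ K)
    (hA : A = K \ K') (hanc : ∀ n ∈ K', ∀ p ∈ K, G.Adj p n → p ∈ K') :
    marg A (fun z => ∏ n ∈ K, M.factor n z) = fun z => ∏ n ∈ K', M.factor n z :=
  marg_prod_of_ancestral (adj_verts_acyclic G) M.factor_congr M.sum_factor_update hK hA hanc

open Classical in
/-- A network given by factors, each of which depends on a variable and its parents only. -/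
noncomputable def ofFactors [∀ n, Nonempty (S n)] (f : G.verts → G.Inst S → ℝ)
    (hnonneg : ∀ n z, 0 ≤ f n z)
    (hsum : ∀ n z, ∑ s, f n (Function.update z n s) = 1) : BN G S where
  cpt n s pa := f n (Function.update
    (fun m => if h : G.Adj m n then pa ⟨m, h⟩ else Classical.arbitrary (S m)) n s)
  cpt_nonneg _ _ _ := hnonneg _ _
  cpt_sum _ _ := hsum _ _

theorem factor_ofFactors [∀ n, Nonempty (S n)] {f : G.verts → G.Inst S → ℝ}
    {hnonneg : ∀ n z, 0 ≤ f n z} {hsum : ∀ n z, ∑ s, f n (Function.update z n s) = 1}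
    (hdep : ∀ n (z z' : G.Inst S), z n = z' n → (∀ p : G.verts, G.Adj p n → z p = z' p) →
      f n z = f n z') (n : G.verts) (z : G.Inst S) :
    (ofFactors f hnonneg hsum).factor n z = f n z := by
  unfold factor ofFactors
  refine hdep n _ _ (by simp) fun p hp => ?_
  rw [Function.update_of_ne]
  · simp [hp, CausalGraph.parentInst]
  · rintro rfl
    exact G.acyclic _ (.single hp)

theorem functional_ofFactors [∀ n, Nonempty (S n)] {f : G.verts → G.Inst S → ℝ}
    {hnonneg : ∀ n z, 0 ≤ f n z} {hsum : ∀ n z, ∑ s, f n (Function.update z n s) = 1}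
    {W : Finset N} (h : ∀ n : G.verts, (n : N) ∈ W → ∀ z, f n z = 0 ∨ f n z = 1) :
    (ofFactors f hnonneg hsum).Functional W :=
  fun n hn _ _ => h n hn _

-- The point masses at `X` become the second condition of the indicator, and the truncated product
-- of the untreated CPTs remains.
open Classical in
theorem effect_eq_sum (M : BN G S) (X Y : Finset N) (x y : G.Inst S) :
    M.effect X x Y y = ∑ z : G.Inst S,
      if (∀ n : G.verts, (n : N) ∈ Y → z n = y n) ∧ (∀ n : G.verts, (n : N) ∈ X → z n = x n)
      then ∏ n ∈ Finset.univ.filter (fun n : G.verts => (n : N) ∉ X), M.factor n z else 0 := by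
  unfold effect prob
  refine Finset.sum_congr rfl fun z _ => ?_
  rw [ite_and]
  refine if_congr Iff.rfl ?_ rfl
  have h1 : (M.mutilate X x).joint z = ∏ n : G.verts,
      if (n : N) ∈ X then (if z n = x n then 1 else 0) else M.factor n z := by
    unfold joint mutilate factor
    refine Finset.prod_congr rfl fun n _ => ?_
    by_cases h : (n : N) ∈ X
    · simp [h]
    · simp only [h, dif_neg, not_false_eq_true, if_false]
      rfl
  rw [h1]
  split_ifs with hx
  · rw [Finset.prod_filter]
    refine Finset.prod_congr rfl fun n _ => ?_
    by_cases h : (n : N) ∈ X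
    · simp [h, hx n h]
    · simp [h]
  · push Not at hx
    obtain ⟨n, hn, hne⟩ := hx
    exact Finset.prod_eq_zero (Finset.mem_univ n) (by simp [hn, hne])

open Classical in
theorem prob_eq_sum (M : BN G S) (A : Finset N) (w : G.Inst S) :
    M.prob A w = ∑ z : G.Inst S,
      if ∀ n : G.verts, (n : N) ∈ A → z n = w n then ∏ n : G.verts, M.factor n z else 0 :=
  rfl

/-- Observation is the empty intervention, so results on effects also cover probabilities. -/
theorem effect_empty (M : BN G S) (Y : Finset N) (x y : G.Inst S) :
    M.effect ∅ x Y y = M.prob Y y := by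
  classical
  rw [effect_eq_sum, prob_eq_sum]
  refine Finset.sum_congr rfl fun z _ => if_congr ?_ ?_ rfl
  · exact and_iff_left fun n hn => absurd hn (Finset.notMem_empty _)
  · rw [Finset.filter_true_of_mem fun n _ => Finset.notMem_empty _]

theorem prob_empty (M : BN G S) (w : G.Inst S) : M.prob ∅ w = 1 := by
  have h := M.marg_prod_factor (K := Finset.univ) (K' := ∅) (A := Finset.univ)
    (Finset.subset_univ _) (by simp) (by simp)
  have := congrFun h w
  simpa [marg, prob_eq_sum] using this

/-- The condition on the empty set of variables is vacuous, because its probability is 1. -/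
theorem satisfies_strictPositivity (M : BN G S) (V : Finset N) :
    (∀ c ∈ ({strictPositivity V} : Set (PositivityConstraint V)), M.Satisfies c) ↔
      ∀ w, 0 < M.prob V w := by
  simp only [Set.mem_singleton_iff, forall_eq, Satisfies, strictPositivity, prob_empty,
    zero_lt_one, true_imp_iff, Finset.union_empty]

end BN

end Factors

end CausalID

namespace CausalID

theorem marg_indep {ι : Type*} [Fintype ι] [DecidableEq ι] {S : ι → Type*}
    [∀ i, Fintype (S i)] {B D : Finset ι} (hBD : Disjoint B D) {F : (∀ i, S i) → ℝ}
    (hF : ∀ z z' : ∀ i, S i, (∀ i, i ∉ D → z i = z' i) → F z = F z') (v w : ∀ i, S i)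
    (h : ∀ i, i ∉ D → v i = w i) : marg B F v = marg B F w := by
  classical
  unfold marg
  rw [← Finset.sum_filter, ← Finset.sum_filter]
  refine Finset.sum_bij' (fun y _ k => if k ∈ D then w k else y k)
    (fun y _ k => if k ∈ D then v k else y k) ?_ ?_ ?_ ?_ ?_
  · intro y hy
    simp only [Finset.mem_filter, Finset.mem_univ, true_and] at hy ⊢
    intro k hk
    split_ifs with hD
    · rfl
    · rw [hy k hk, h k hD]
  · intro y hy
    simp only [Finset.mem_filter, Finset.mem_univ, true_and] at hy ⊢
    intro k hk
    split_ifs with hD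
    · rfl
    · rw [hy k hk, h k hD]
  · intro y hy
    simp only [Finset.mem_filter, Finset.mem_univ, true_and] at hy
    funext k
    by_cases hD : k ∈ D
    · simpa [hD] using (hy k (Finset.disjoint_right.1 hBD hD)).symm
    · simp [hD]
  · intro y hy
    simp only [Finset.mem_filter, Finset.mem_univ, true_and] at hy
    funext k
    by_cases hD : k ∈ D
    · simpa [hD] using (hy k (Finset.disjoint_right.1 hBD hD)).symm
    · simp [hD]
  · intro y hy
    refine hF _ _ fun i hi => ?_
    simp [hi]

/-! ### Hidden paths, functional elimination and bidirected edges. -/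

namespace CausalGraph

variable {N : Type u} {G : CausalGraph N} {V : Finset N}

theorem HiddenPath.trans {a c b : N} (h : G.HiddenPath V a c) (hc : c ∉ V)
    (h' : G.HiddenPath V c b) : G.HiddenPath V a b := by
  induction h with
  | edge h => exact .cons h hc h'
  | cons h hd _ ih => exact .cons h hd (ih hc h')

theorem HiddenPath.exists_last {a b : N} (h : G.HiddenPath V a b) :
    ∃ p, G.Adj p b ∧ (p = a ∨ (p ∉ V ∧ G.HiddenPath V a p)) := by
  induction h with
  | edge h => exact ⟨_, h, .inl rfl⟩
  | cons h hc _ ih =>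
    obtain ⟨p, hp, rfl | ⟨hpV, hp'⟩⟩ := ih
    · exact ⟨_, hp, .inr ⟨hc, .edge h⟩⟩
    · exact ⟨p, hp, .inr ⟨hpV, .cons h hc hp'⟩⟩

theorem HiddenPath.left_mem {a b : N} (h : G.HiddenPath V a b) : a ∈ G.verts := by
  cases h with
  | edge h => exact G.left_mem h
  | cons h _ _ => exact G.left_mem h

variable [DecidableEq N]

/-- A passage through the hidden variable `x` is traded for the edge from its predecessor to its
successor, and back. -/
theorem hiddenPath_elim {x a b : N} (hx : x ∉ V) (ha : a ≠ x) (hb : b ≠ x) :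
    (G.elim x).HiddenPath V a b ↔ G.HiddenPath V a b := by
  constructor
  · intro h
    induction h with
    | edge h =>
      rcases h with ⟨_, _, h | h⟩
      · exact .edge h
      · exact .cons h.1 hx (.edge h.2)
    | cons h hc _ ih =>
      have ih := ih h.2.1 hb
      rcases h with ⟨_, _, h | h⟩
      · exact .cons h hc ih
      · exact .cons h.1 hx (.cons h.2 hc ih)
  · intro h
    -- The induction meets tails that start at `x` itself; for these the claim is made about each
    -- parent `p` of `x` instead.
    have key : (a ≠ x → (G.elim x).HiddenPath V a b) ∧
        (a = x → ∀ p, p ≠ x → G.Adj p x → (G.elim x).HiddenPath V p b) := by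
      clear ha
      induction h with
      | edge h =>
        refine ⟨fun ha => .edge ⟨ha, hb, .inl h⟩, ?_⟩
        rintro rfl p hp hpx
        exact .edge ⟨hp, hb, .inr ⟨hpx, h⟩⟩
      | @cons a c b h hc _ ih =>
        have ih := ih hb
        constructor
        · intro ha
          by_cases hcx : c = x
          · subst hcx
            exact ih.2 rfl a ha h
          · exact .cons ⟨ha, hcx, .inl h⟩ hc (ih.1 hcx)
        · rintro rfl p hp hpx
          have hca : c ≠ a := by
            rintro rfl
            exact G.acyclic _ (.single h)
          exact .cons ⟨hp, hca, .inr ⟨hpx, h⟩⟩ hc (ih.1 hca)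
    exact key.1 ha

theorem hiddenPath_elimSet {W : Finset N} (hWV : Disjoint W V) {a b : N} (ha : a ∉ W)
    (hb : b ∉ W) : (G.elimSet W).HiddenPath V a b ↔ G.HiddenPath V a b := by
  have key : ∀ (s : Multiset N) (G : CausalGraph N), (∀ x ∈ s, x ∉ V) → a ∉ s → b ∉ s →
      ((s.foldl elim G).HiddenPath V a b ↔ G.HiddenPath V a b) := by
    intro s
    induction s using Multiset.induction with
    | empty => simp
    | cons x s ih =>
      intro G hs ha hb
      rw [Multiset.mem_cons, not_or] at ha hb
      rw [Multiset.foldl_cons, ih _ (fun y hy => hs y (Multiset.mem_cons_of_mem hy)) ha.2 hb.2,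
        hiddenPath_elim (hs x (Multiset.mem_cons_self x s)) ha.1 hb.1]
  exact key W.val G (fun x hx => Finset.disjoint_left.1 hWV hx) ha hb

theorem notMem_of_mem_verts_elimSet {W : Finset N} {a : N} (h : a ∈ (G.elimSet W).verts) :
    a ∉ W := by
  have key : ∀ (s : Multiset N) (G : CausalGraph N), a ∈ (s.foldl elim G).verts →
      a ∈ G.verts ∧ a ∉ s := by
    intro s
    induction s using Multiset.induction with
    | empty => simp
    | cons x s ih =>
      intro G h
      rw [Multiset.foldl_cons] at h
      obtain ⟨h1, h2⟩ := ih _ h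
      have h3 := Finset.mem_erase.1 h1
      exact ⟨h3.2, by simp [h3.1, h2]⟩
  exact (key W.val G h).2

/-- The sources outside `W` are the ones that survive elimination, and their hidden paths to
observed variables are unchanged. -/
theorem mem_bidirected_elimSet {W : Finset N} (hWV : Disjoint W V) {a b : N}
    (ha : a ∈ V) (hb : b ∈ V) : s(a, b) ∈ (G.elimSet W).bidirected V ↔
      a ≠ b ∧ ∃ h, h ∉ V ∧ h ∉ W ∧ G.HiddenPath V h a ∧ G.HiddenPath V h b := by
  classical
  have haW : a ∉ W := Finset.disjoint_right.1 hWV ha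
  have hbW : b ∉ W := Finset.disjoint_right.1 hWV hb
  unfold bidirected
  simp only [Finset.mem_filter, Finset.mk_mem_sym2_iff, ha, hb, Sym2.mk_isDiag_iff,
    Sym2.mem_iff, forall_eq_or_imp, forall_eq, true_and, and_self]
  refine and_congr_right fun _ => exists_congr fun h => and_congr_right fun _ => ?_
  constructor
  · rintro ⟨h1, h2⟩
    have hW := notMem_of_mem_verts_elimSet h1.left_mem
    exact ⟨hW, (hiddenPath_elimSet hWV hW haW).1 h1, (hiddenPath_elimSet hWV hW hbW).1 h2⟩
  · rintro ⟨hW, h1, h2⟩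
    exact ⟨(hiddenPath_elimSet hWV hW haW).2 h1, (hiddenPath_elimSet hWV hW hbW).2 h2⟩

/-- The variables of `G` that are in `A`. -/
def sel (G : CausalGraph N) (A : Finset N) : Finset G.verts :=
  Finset.univ.filter fun n => (n : N) ∈ A

@[simp]
theorem mem_sel {A : Finset N} {n : G.verts} : n ∈ G.sel A ↔ (n : N) ∈ A := by
  simp [sel]

/-- The variables of `G` that are not in `A`. -/
def unsel (G : CausalGraph N) (A : Finset N) : Finset G.verts :=
  Finset.univ.filter fun n => (n : N) ∉ A

@[simp]
theorem mem_unsel {A : Finset N} {n : G.verts} : n ∈ G.unsel A ↔ (n : N) ∉ A := by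
  simp [unsel]

open Classical in
/-- The hidden variables with a hidden path to a variable in `C`. -/
noncomputable def hiddenAnc (G : CausalGraph N) (V C : Finset N) : Finset G.verts :=
  Finset.univ.filter fun n => (n : N) ∉ V ∧ ∃ c ∈ C, G.HiddenPath V n c

theorem mem_hiddenAnc {C : Finset N} {n : G.verts} :
    n ∈ G.hiddenAnc V C ↔ (n : N) ∉ V ∧ ∃ c ∈ C, G.HiddenPath V n c := by
  simp [hiddenAnc]

theorem mem_hiddenAnc_of_adj {C : Finset N} {n p : G.verts} (hp : (p : N) ∉ V)
    (h : G.Adj p n) (hn : (n : N) ∈ C ∨ n ∈ G.hiddenAnc V C) : p ∈ G.hiddenAnc V C := by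
  rw [mem_hiddenAnc]
  refine ⟨hp, ?_⟩
  rcases hn with hn | hn
  · exact ⟨n, hn, .edge h⟩
  · obtain ⟨hnV, c, hc, hnc⟩ := mem_hiddenAnc.1 hn
    exact ⟨c, hc, .cons h hnV hnc⟩

end CausalGraph

/-! ### Kernels: marginalization to ancestral sets, factorization, and causal effects. -/

namespace BN

variable {N : Type u} [DecidableEq N] {G : CausalGraph N} {S : N → Type u}
  [∀ n, Fintype (S n)]

/-- The distribution of the variables in `C` under an intervention on the other observed
variables: `kernel M V C v` is the probability of `v` in `V` under `do(v)` in `V \ C`. -/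
noncomputable def kernel (M : BN G S) (V C : Finset N) : G.Inst S → ℝ :=
  marg (G.unsel V) fun z => ∏ n ∈ G.unsel V ∪ G.sel C, M.factor n z

theorem prob_eq_kernel (M : BN G S) (V : Finset N) (w : G.Inst S) :
    M.prob V w = M.kernel V V w := by
  classical
  have : G.unsel V ∪ G.sel V = Finset.univ := by
    ext n; simp [em']
  rw [kernel, prob_eq_sum, this, marg]
  refine Finset.sum_congr rfl fun z _ => if_congr ?_ rfl rfl
  simp

variable (M : BN G S) {V C C' : Finset N}

/-- By `hanc`, `C'` together with its hidden ancestors is closed under parents among the variables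
that carry factors, so all other factors sum out to 1. With `C' = C` this discards irrelevant hidden
variables from a kernel; in general it is the ancestral rule for kernels. -/
theorem marg_prod_factor_hiddenAnc (hC : C ⊆ V) (hC' : C' ⊆ C)
    (hanc : ∀ b ∈ C', ∀ a ∈ C, G.HiddenPath V a b → a ∈ C') :
    marg (G.unsel V ∪ G.sel (C \ C')) (fun z => ∏ n ∈ G.unsel V ∪ G.sel C, M.factor n z) =
      marg (G.hiddenAnc V C') (fun z => ∏ n ∈ G.hiddenAnc V C' ∪ G.sel C', M.factor n z) := by
  classical
  have hsub : G.hiddenAnc V C' ∪ G.sel C' ⊆ G.unsel V ∪ G.sel C := by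
    intro n hn
    rcases Finset.mem_union.1 hn with hn | hn
    · exact Finset.mem_union_left _ (by simpa using (CausalGraph.mem_hiddenAnc.1 hn).1)
    · exact Finset.mem_union_right _ (by simpa using hC' (by simpa using hn))
  rw [← marg_marg (A := G.hiddenAnc V C')
    (B := (G.unsel V ∪ G.sel C) \ (G.hiddenAnc V C' ∪ G.sel C'))]
  · rw [M.marg_prod_factor hsub rfl]
    intro n hn p hp hadj
    rw [Finset.mem_union, CausalGraph.mem_sel] at hn hp ⊢
    rw [CausalGraph.mem_unsel] at hp
    rcases hp with hp | hp
    · exact .inl (CausalGraph.mem_hiddenAnc_of_adj hp hadj hn.symm)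
    · rcases hn with hn | hn
      · obtain ⟨hnV, c, hc, hnc⟩ := CausalGraph.mem_hiddenAnc.1 hn
        exact .inr (hanc c hc p hp (.cons hadj hnV hnc))
      · exact .inr (hanc n hn p hp (.edge hadj))
  · refine Finset.disjoint_sdiff.mono_left Finset.subset_union_left
  · ext n
    have h1 : n ∈ G.hiddenAnc V C' → (n : N) ∉ V := fun h => (CausalGraph.mem_hiddenAnc.1 h).1
    have h2 : (n : N) ∈ C → (n : N) ∈ V := fun h => hC h
    have h3 : (n : N) ∈ C' → (n : N) ∈ C := fun h => hC' h
    simp only [Finset.mem_union, Finset.mem_sdiff, CausalGraph.mem_sel, CausalGraph.mem_unsel]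
    tauto

theorem kernel_eq_marg_hiddenAnc (hC : C ⊆ V) : M.kernel V C =
    marg (G.hiddenAnc V C) (fun z => ∏ n ∈ G.hiddenAnc V C ∪ G.sel C, M.factor n z) := by
  rw [← M.marg_prod_factor_hiddenAnc hC (Finset.Subset.refl C) fun _ _ a ha _ => ha, kernel]
  congr 1
  ext n
  simp

theorem marg_kernel_of_ancestral (hC : C ⊆ V) (hC' : C' ⊆ C)
    (hanc : ∀ b ∈ C', ∀ a ∈ C, G.HiddenPath V a b → a ∈ C') :
    marg (G.sel (C \ C')) (M.kernel V C) = M.kernel V C' := by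
  rw [M.kernel_eq_marg_hiddenAnc (hC'.trans hC), ← M.marg_prod_factor_hiddenAnc hC hC' hanc,
    kernel, marg_marg _ (Finset.union_comm _ _)]
  rw [Finset.disjoint_left]
  intro n hn
  simp only [CausalGraph.mem_sel, Finset.mem_sdiff, CausalGraph.mem_unsel, not_not] at hn ⊢
  exact hC hn.1

theorem kernel_empty : M.kernel V ∅ = fun _ => 1 := by
  rw [M.kernel_eq_marg_hiddenAnc (Finset.empty_subset V)]
  have h1 : G.hiddenAnc V ∅ = ∅ := by
    ext n; simp [CausalGraph.mem_hiddenAnc]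
  have h2 : G.sel ∅ = ∅ := by
    ext n; simp
  rw [h1, h2, marg_empty]
  simp

theorem factor_zero_or_one {W : Finset N} (hW : M.Functional W) {n : G.verts}
    (hn : (n : N) ∈ W) (z : G.Inst S) : M.factor n z = 0 ∨ M.factor n z = 1 :=
  hW n hn _ _

theorem prod_factor_indep {K D : Finset G.verts} (h1 : ∀ n ∈ K, n ∉ D)
    (h2 : ∀ n ∈ K, ∀ p : G.verts, G.Adj p n → p ∉ D) (z z' : G.Inst S)
    (h : ∀ i, i ∉ D → z i = z' i) : ∏ n ∈ K, M.factor n z = ∏ n ∈ K, M.factor n z' :=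
  Finset.prod_congr rfl fun n hn =>
    M.factor_congr n z z' (h n (h1 n hn)) fun p hp => h p (h2 n hn p hp)

-- The only place where functionality matters for soundness. The hidden ancestors common to `C₁` and
-- `C₂` lie in `W`; once they are fixed, the two sides have no hidden variable in common, and the
-- sum over the common ones is evaluation at a single point.
set_option maxHeartbeats 800000 in
theorem kernel_union {W C₁ C₂ : Finset N} (hW : M.Functional W) (hC₁ : C₁ ⊆ V) (hC₂ : C₂ ⊆ V)
    (hd : Disjoint C₁ C₂)
    (hbi : ∀ a ∈ C₁, ∀ b ∈ C₂, ¬ ∃ h, h ∉ V ∧ h ∉ W ∧ G.HiddenPath V h a ∧ G.HiddenPath V h b)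
    (v : G.Inst S) :
    M.kernel V (C₁ ∪ C₂) v = M.kernel V C₁ v * M.kernel V C₂ v := by
  classical
  set L₁ := G.hiddenAnc V C₁ with hL₁
  set L₂ := G.hiddenAnc V C₂ with hL₂
  set I := L₁ ∩ L₂ with hI
  have hLV₁ : ∀ n ∈ L₁, (n : N) ∉ V := fun n h => (CausalGraph.mem_hiddenAnc.1 h).1
  have hLV₂ : ∀ n ∈ L₂, (n : N) ∉ V := fun n h => (CausalGraph.mem_hiddenAnc.1 h).1
  have hIW : ∀ n ∈ I, (n : N) ∈ W := by
    intro n hn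
    obtain ⟨h1, h2⟩ := Finset.mem_inter.1 hn
    obtain ⟨hnV, a, ha, hna⟩ := CausalGraph.mem_hiddenAnc.1 h1
    obtain ⟨_, b, hb, hnb⟩ := CausalGraph.mem_hiddenAnc.1 h2
    by_contra hnW
    exact hbi a ha b hb ⟨n, hnV, hnW, hna, hnb⟩
  have hL : G.hiddenAnc V (C₁ ∪ C₂) = L₁ ∪ L₂ := by
    ext n
    simp only [hL₁, hL₂, CausalGraph.mem_hiddenAnc, Finset.mem_union]
    constructor
    · rintro ⟨h, c, hc | hc, h'⟩
      · exact .inl ⟨h, c, hc, h'⟩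
      · exact .inr ⟨h, c, hc, h'⟩
    · rintro (⟨h, c, hc, h'⟩ | ⟨h, c, hc, h'⟩)
      · exact ⟨h, c, .inl hc, h'⟩
      · exact ⟨h, c, .inr hc, h'⟩
  set F₀ : G.Inst S → ℝ := fun z => ∏ n ∈ I, M.factor n z with hF₀
  set F₁ : G.Inst S → ℝ := fun z => ∏ n ∈ (L₁ \ I) ∪ G.sel C₁, M.factor n z with hF₁
  set F₂ : G.Inst S → ℝ := fun z => ∏ n ∈ (L₂ \ I) ∪ G.sel C₂, M.factor n z with hF₂
  have hCV₁ : ∀ n : G.verts, (n : N) ∈ C₁ → (n : N) ∈ V := fun n h => hC₁ h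
  have hCV₂ : ∀ n : G.verts, (n : N) ∈ C₂ → (n : N) ∈ V := fun n h => hC₂ h
  have hdis : ∀ n : G.verts, (n : N) ∈ C₁ → (n : N) ∉ C₂ :=
    fun n h => Finset.disjoint_left.1 hd h
  have mI : ∀ n, n ∈ I ↔ n ∈ L₁ ∧ n ∈ L₂ := fun n => Finset.mem_inter
  -- A hidden parent of a variable on side 1 is in `L₁`; if it is also in `L₂`, it is in `I`. Hence
  -- the factors of one side do not depend on the private hidden variables of the other.
  have hpar₁ : ∀ n p : G.verts, (n : N) ∈ C₁ ∨ n ∈ L₁ → G.Adj p n → p ∉ L₂ \ I := by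
    intro n p hn hadj hp
    obtain ⟨hp, hpI⟩ := Finset.mem_sdiff.1 hp
    exact hpI ((mI p).2 ⟨CausalGraph.mem_hiddenAnc_of_adj (hLV₂ p hp) hadj hn, hp⟩)
  have hpar₂ : ∀ n p : G.verts, (n : N) ∈ C₂ ∨ n ∈ L₂ → G.Adj p n → p ∉ L₁ \ I := by
    intro n p hn hadj hp
    obtain ⟨hp, hpI⟩ := Finset.mem_sdiff.1 hp
    exact hpI ((mI p).2 ⟨hp, CausalGraph.mem_hiddenAnc_of_adj (hLV₁ p hp) hadj hn⟩)
  have ind₀₁ := M.prod_factor_indep (K := I) (D := L₁ \ I)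
    (fun n hn h => (Finset.mem_sdiff.1 h).2 hn)
    fun n hn p hp => hpar₂ n p (.inr ((mI n).1 hn).2) hp
  have ind₀₂ := M.prod_factor_indep (K := I) (D := L₂ \ I)
    (fun n hn h => (Finset.mem_sdiff.1 h).2 hn)
    fun n hn p hp => hpar₁ n p (.inr ((mI n).1 hn).1) hp
  have ind₁ := M.prod_factor_indep (K := (L₁ \ I) ∪ G.sel C₁) (D := L₂ \ I)
    (by
      intro n hn h
      obtain ⟨h2, h3⟩ := Finset.mem_sdiff.1 h
      rcases Finset.mem_union.1 hn with h4 | h4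
      · exact h3 ((mI n).2 ⟨(Finset.mem_sdiff.1 h4).1, h2⟩)
      · exact hLV₂ n h2 (hCV₁ n (by simpa using h4)))
    (by
      intro n hn p hp
      refine hpar₁ n p ?_ hp
      rcases Finset.mem_union.1 hn with h4 | h4
      · exact .inr (Finset.mem_sdiff.1 h4).1
      · exact .inl (by simpa using h4))
  have ind₂ := M.prod_factor_indep (K := (L₂ \ I) ∪ G.sel C₂) (D := L₁ \ I)
    (by
      intro n hn h
      obtain ⟨h2, h3⟩ := Finset.mem_sdiff.1 h
      rcases Finset.mem_union.1 hn with h4 | h4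
      · exact h3 ((mI n).2 ⟨h2, (Finset.mem_sdiff.1 h4).1⟩)
      · exact hLV₁ n h2 (hCV₂ n (by simpa using h4)))
    (by
      intro n hn p hp
      refine hpar₂ n p ?_ hp
      rcases Finset.mem_union.1 hn with h4 | h4
      · exact .inr (Finset.mem_sdiff.1 h4).1
      · exact .inl (by simpa using h4))
  have hL12 : Disjoint (L₁ \ I) (L₂ \ I) := by
    rw [Finset.disjoint_left]
    intro n h1 h2
    simp only [Finset.mem_sdiff, mI] at h1 h2
    tauto
  have hkernel₁ : M.kernel V C₁ = marg I (fun z => F₀ z * marg (L₁ \ I) F₁ z) := by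
    rw [M.kernel_eq_marg_hiddenAnc hC₁, ← marg_marg (A := I) (B := L₁ \ I)
      Finset.disjoint_sdiff (by ext n; simp [mI]; tauto)]
    congr 1
    funext z
    rw [← marg_mul_left ind₀₁]
    congr 1
    funext z
    rw [← Finset.prod_union]
    · refine Finset.prod_congr ?_ fun _ _ => rfl
      ext n; simp [mI]; tauto
    · rw [Finset.disjoint_left]
      intro n h1 h2
      have := hCV₁ n
      have := hLV₁ n
      simp only [Finset.mem_sdiff, mI, Finset.mem_union, CausalGraph.mem_sel] at h1 h2
      tauto
  have hkernel₂ : M.kernel V C₂ = marg I (fun z => F₀ z * marg (L₂ \ I) F₂ z) := by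
    rw [M.kernel_eq_marg_hiddenAnc hC₂, ← marg_marg (A := I) (B := L₂ \ I)
      Finset.disjoint_sdiff (by ext n; simp [mI]; tauto)]
    congr 1
    funext z
    rw [← marg_mul_left ind₀₂]
    congr 1
    funext z
    rw [← Finset.prod_union]
    · refine Finset.prod_congr ?_ fun _ _ => rfl
      ext n; simp [mI]; tauto
    · rw [Finset.disjoint_left]
      intro n h1 h2
      have := hCV₂ n
      have := hLV₂ n
      simp only [Finset.mem_sdiff, mI, Finset.mem_union, CausalGraph.mem_sel] at h1 h2
      tauto
  have hkernel : M.kernel V (C₁ ∪ C₂) =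
      marg I (fun z => F₀ z * (marg (L₁ \ I) F₁ z * marg (L₂ \ I) F₂ z)) := by
    rw [M.kernel_eq_marg_hiddenAnc (Finset.union_subset hC₁ hC₂), hL,
      ← marg_marg (A := I) (B := (L₁ \ I) ∪ (L₂ \ I))
        (by rw [Finset.disjoint_left]; intro n h1 h2; simp [mI] at h1 h2; tauto)
        (by ext n; simp [mI]; tauto),
      ← marg_marg hL12 rfl]
    congr 1
    have hsplit : (fun z => ∏ n ∈ L₁ ∪ L₂ ∪ G.sel (C₁ ∪ C₂), M.factor n z) =
        fun z => (F₀ z * F₁ z) * F₂ z := by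
      funext z
      simp only [hF₀, hF₁, hF₂]
      rw [← Finset.prod_union, ← Finset.prod_union]
      · refine Finset.prod_congr ?_ fun _ _ => rfl
        ext n; simp [mI]; tauto
      · rw [Finset.disjoint_left]
        intro n h1 h2
        simp only [Finset.mem_sdiff, mI, Finset.mem_union, CausalGraph.mem_sel] at h1 h2
        rcases h2 with h2 | h2
        · rcases h1 with h1 | h1 | h1
          · exact h2.2 h1
          · exact h1.2 ⟨h1.1, h2.1⟩
          · exact hLV₂ n h2.1 (hCV₁ n h1)
        · rcases h1 with h1 | h1 | h1
          · exact hLV₁ n h1.1 (hCV₂ n h2)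
          · exact hLV₁ n h1.1 (hCV₂ n h2)
          · exact hdis n h1 h2
      · rw [Finset.disjoint_left]
        intro n h1 h2
        have := hCV₁ n
        have := hLV₁ n
        simp only [Finset.mem_sdiff, mI, Finset.mem_union, CausalGraph.mem_sel] at h1 h2
        tauto
    rw [hsplit]
    have h2 : marg (L₂ \ I) (fun z => (F₀ z * F₁ z) * F₂ z) =
        fun z => (F₀ z * marg (L₂ \ I) F₂ z) * F₁ z := by
      funext z
      rw [marg_mul_left (g := fun z => F₀ z * F₁ z)]
      · ring
      · intro z z' h
        exact congrArg₂ _ (ind₀₂ z z' h) (ind₁ z z' h)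
    rw [h2]
    funext z
    rw [marg_mul_left (g := fun z => F₀ z * marg (L₂ \ I) F₂ z)]
    · ring
    · intro z z' h
      exact congrArg₂ _ (ind₀₁ z z' h) (marg_indep hL12.symm ind₂ z z' h)
  have h01 : ∀ z, F₀ z = 0 ∨ F₀ z = 1 := by
    intro z
    by_cases h : ∃ n ∈ I, M.factor n z = 0
    · obtain ⟨n, hn, h⟩ := h
      exact .inl (Finset.prod_eq_zero hn h)
    · push Not at h
      exact .inr (Finset.prod_eq_one fun n hn =>
        (M.factor_zero_or_one hW (hIW n hn) z).resolve_left (h n hn))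
  have hone : marg I F₀ v = 1 := by
    have := congrFun (M.marg_prod_factor (K := I) (K' := ∅) (A := I)
      (Finset.empty_subset _) (by simp) (by simp)) v
    simpa using this
  -- The point `z₀` depends on `v` but not on the integrand, so all three kernels are evaluated at
  -- the same point.
  obtain ⟨z₀, hz₀⟩ := marg_mul_of_zero_or_one h01 hone
  rw [hkernel, hkernel₁, hkernel₂, hz₀, hz₀, hz₀]

/-- The kernel of `V \ X` is the truncated product with the hidden variables summed out. Its
marginal on the ancestral set `A` is the kernel of `A`, and it remains to sum out `A \ Y`. -/
theorem effect_eq_marg_kernel {X Y A : Finset N} (hX : X ⊆ V) (hY : Y ⊆ V) (hA : A ⊆ V \ X)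
    (hYA : Y \ X ⊆ A) (hanc : ∀ b ∈ A, ∀ a ∈ V \ X, G.HiddenPath V a b → a ∈ A)
    {x y v : G.Inst S} (hx : ∀ n : G.verts, (n : N) ∈ X → v n = x n)
    (hy : ∀ n : G.verts, (n : N) ∈ Y → v n = y n) :
    M.effect X x Y y = marg (G.sel (A \ Y)) (M.kernel V A) v := by
  classical
  rw [← M.marg_kernel_of_ancestral Finset.sdiff_subset hA hanc,
    marg_marg (C := G.sel ((V \ X) \ Y)), kernel, marg_marg (C := G.unsel (X ∪ Y)),
    effect_eq_sum, marg]
  · refine Finset.sum_congr rfl fun z _ => if_congr ?_ ?_ rfl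
    · constructor
      · rintro ⟨h1, h2⟩ n hn
        simp only [CausalGraph.mem_unsel, Finset.mem_union, not_not] at hn
        rcases hn with hn | hn
        · rw [h2 n hn, hx n hn]
        · rw [h1 n hn, hy n hn]
      · intro h
        exact ⟨fun n hn => by rw [h n (by simp [hn]), hy n hn],
          fun n hn => by rw [h n (by simp [hn]), hx n hn]⟩
    · refine Finset.prod_congr ?_ fun _ _ => rfl
      ext n
      have := @hX n
      simp
      tauto
  · rw [Finset.disjoint_left]
    intro n h1 h2
    simp at h1 h2
    tauto
  · ext n
    have := @hX n
    have := @hY n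
    simp
    tauto
  · rw [Finset.disjoint_left]
    intro n h1 h2
    simp at h1 h2
    tauto
  · ext n
    have h1 := @hA n
    have h2 := @hYA n
    simp only [Finset.mem_sdiff, CausalGraph.mem_sel, Finset.mem_union] at h1 h2 ⊢
    tauto

end BN

end CausalID

/-! ### Hedges as the combinatorial obstruction to identification. -/

namespace CausalID

/-- In a finite set, an acyclic relation has a sink. -/
theorem exists_sink {N : Type*} {r : N → N → Prop} (hr : ∀ a, ¬ Relation.TransGen r a a)
    {T : Finset N} (hT : T.Nonempty) : ∃ n ∈ T, ∀ m ∈ T, ¬ r n m := by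
  classical
  let r' : T → T → Prop := fun a b => Relation.TransGen r b a
  have : IsTrans T r' := ⟨fun a b c h1 h2 => h2.trans h1⟩
  have : Std.Irrefl r' := ⟨fun a h => hr a h⟩
  have hwf : WellFounded r' := Finite.wellFounded_of_trans_of_irrefl _
  obtain ⟨n, _, hn⟩ := hwf.has_min Set.univ (by
    obtain ⟨t, ht⟩ := hT
    exact ⟨⟨t, ht⟩, trivial⟩)
  exact ⟨n, n.2, fun m hm h => hn ⟨m, hm⟩ trivial (.single h)⟩

section Hedges

variable {N : Type u}

/-- Every nonempty proper subset of `F` has an `r`-edge to its complement in `F`. -/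
def ConnectedOn (r : N → N → Prop) (F : Finset N) : Prop :=
  ∀ T ⊆ F, T.Nonempty → T ≠ F → ∃ a ∈ T, ∃ b ∈ F, b ∉ T ∧ r a b

/-- A hedge `(F, D)` for the causal effect of `X` on `Y`, where `D` lies in the set `A` of
variables from which `Y` can be reached without passing through `X`. -/
structure IsHedge (dir bi : N → N → Prop) (V X Y F D A : Finset N) : Prop where
  F_subset : F ⊆ V
  D_subset : D ⊆ F
  D_nonempty : D.Nonempty
  F_connected : ConnectedOn bi F
  D_connected : ConnectedOn bi D
  meets : ∃ x ∈ F, x ∈ X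
  A_subset : A ⊆ V
  A_avoids : ∀ a ∈ A, a ∉ X
  D_subset_A : D ⊆ A
  child_F : ∀ v ∈ F, v ∉ D → ∃ w ∈ F, dir v w
  child_A : ∀ v ∈ A, v ∉ Y → ∃ w ∈ A, dir v w

variable [DecidableEq N] {dir bi : N → N → Prop} {V X Y : Finset N}

/-- Among the ancestral sets containing `Y \ X`, one of least cardinality works: an element outside
`Y` without a child in it could be erased. -/
theorem exists_ancestral_hull (hY : Y ⊆ V) : ∃ A ⊆ V \ X, Y \ X ⊆ A ∧
    (∀ b ∈ A, ∀ a ∈ V \ X, dir a b → a ∈ A) ∧ ∀ v ∈ A, v ∉ Y → ∃ w ∈ A, dir v w := by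
  classical
  set 𝒜 := (V \ X).powerset.filter fun A =>
    Y \ X ⊆ A ∧ ∀ b ∈ A, ∀ a ∈ V \ X, dir a b → a ∈ A with h𝒜
  have hne : 𝒜.Nonempty := by
    refine ⟨V \ X, ?_⟩
    simp only [h𝒜, Finset.mem_filter, Finset.mem_powerset]
    exact ⟨Finset.Subset.refl _, Finset.sdiff_subset_sdiff hY (Finset.Subset.refl _),
      fun _ _ _ h _ => h⟩
  obtain ⟨A, hA, hmin⟩ := Finset.exists_min_image 𝒜 Finset.card hne
  simp only [h𝒜, Finset.mem_filter, Finset.mem_powerset] at hA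
  obtain ⟨hAV, hYA, hanc⟩ := hA
  refine ⟨A, hAV, hYA, hanc, fun v hv hvY => ?_⟩
  by_contra! hno
  have : A.erase v ∈ 𝒜 := by
    simp only [h𝒜, Finset.mem_filter, Finset.mem_powerset]
    refine ⟨(Finset.erase_subset _ _).trans hAV, fun y hy => ?_, fun b hb a ha hab => ?_⟩
    · refine Finset.mem_erase.2 ⟨?_, hYA hy⟩
      rintro rfl
      exact hvY (Finset.mem_sdiff.1 hy).1
    · have hb' := Finset.mem_of_mem_erase hb
      refine Finset.mem_erase.2 ⟨?_, hanc b hb' a ha hab⟩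
      rintro rfl
      exact hno b hb' hab
  exact absurd (hmin _ this) (by rw [not_le]; exact Finset.card_erase_lt_of_mem hv)

/-- A nonempty set has a nonempty connected subset without edges to the rest of the set. -/
theorem exists_component {A : Finset N} (hA : A.Nonempty) (hsymm : ∀ a b, bi a b → bi b a) :
    ∃ D ⊆ A, D.Nonempty ∧ (∀ a ∈ D, ∀ b ∈ A, b ∉ D → ¬ bi a b) ∧ ConnectedOn bi D := by
  classical
  set 𝒟 := A.powerset.filter fun D =>
    D.Nonempty ∧ ∀ a ∈ D, ∀ b ∈ A, b ∉ D → ¬ bi a b with h𝒟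
  have hne : 𝒟.Nonempty := by
    refine ⟨A, ?_⟩
    simp only [h𝒟, Finset.mem_filter, Finset.mem_powerset]
    exact ⟨Finset.Subset.refl _, hA, fun _ _ _ h h' => absurd h h'⟩
  obtain ⟨D, hD, hmin⟩ := Finset.exists_min_image 𝒟 Finset.card hne
  simp only [h𝒟, Finset.mem_filter, Finset.mem_powerset] at hD
  obtain ⟨hDA, hDne, hcl⟩ := hD
  refine ⟨D, hDA, hDne, hcl, fun T hT hTne hTD => ?_⟩
  by_contra! hno
  have : T ∈ 𝒟 := by
    simp only [h𝒟, Finset.mem_filter, Finset.mem_powerset]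
    refine ⟨hT.trans hDA, hTne, fun a ha b hb hbT => ?_⟩
    by_cases hbD : b ∈ D
    · exact hno a ha b hbD hbT
    · exact hcl a (hT ha) b hb hbD
  exact absurd (hmin _ this) (by
    rw [not_le]; exact Finset.card_lt_card (hT.ssubset_of_ne hTD))

/-- Think of `P C` as "the kernel of `C` can be computed from `Pr(V)`". The set `F` is a smallest
one with `P` that contains the component `D`. Neither rule can shrink `F` further, and this is what
the hedge conditions express. -/
theorem exists_isHedge_of_not {P : Finset N → Prop} (hdir : ∀ a, ¬ Relation.TransGen dir a a)
    (hsymm : ∀ a b, bi a b → bi b a) (hPV : ∀ C, P C → C ⊆ V) (hV : P V)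
    (hanc : ∀ C C', P C → C' ⊆ C → (∀ b ∈ C', ∀ a ∈ C, dir a b → a ∈ C') → P C')
    (hsplit : ∀ C₁ C₂, P (C₁ ∪ C₂) → Disjoint C₁ C₂ → (∀ a ∈ C₁, ∀ b ∈ C₂, ¬ bi a b) →
      P C₁ ∧ P C₂)
    {A D : Finset N} (hA : A ⊆ V \ X) (hAanc : ∀ b ∈ A, ∀ a ∈ V \ X, dir a b → a ∈ A)
    (hAY : ∀ v ∈ A, v ∉ Y → ∃ w ∈ A, dir v w) (hDA : D ⊆ A) (hD : D.Nonempty)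
    (hDcl : ∀ a ∈ D, ∀ b ∈ A, b ∉ D → ¬ bi a b) (hDcon : ConnectedOn bi D) (hPD : ¬ P D) :
    ∃ F, IsHedge dir bi V X Y F D A := by
  classical
  have hAV : A ⊆ V := hA.trans Finset.sdiff_subset
  set ℱ := V.powerset.filter fun F => D ⊆ F ∧ P F with hℱ
  have hne : ℱ.Nonempty := by
    refine ⟨V, ?_⟩
    simp only [hℱ, Finset.mem_filter, Finset.mem_powerset]
    exact ⟨Finset.Subset.refl _, hDA.trans hAV, hV⟩
  obtain ⟨F, hF, hmin⟩ := Finset.exists_min_image ℱ Finset.card hne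
  simp only [hℱ, Finset.mem_filter, Finset.mem_powerset] at hF
  obtain ⟨hFV, hDF, hPF⟩ := hF
  have hmin' : ∀ T ⊆ F, T ≠ F → D ⊆ T → ¬ P T := by
    intro T hT hTF hDT hPT
    have : T ∈ ℱ := by
      simp only [hℱ, Finset.mem_filter, Finset.mem_powerset]
      exact ⟨hT.trans hFV, hDT, hPT⟩
    exact absurd (hmin _ this) (by
      rw [not_le]; exact Finset.card_lt_card (hT.ssubset_of_ne hTF))
  have hDneF : D ≠ F := by
    rintro rfl
    exact hPD hPF
  have hFcon : ConnectedOn bi F := by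
    -- If no edge left `T`, then `T` and `F \ T` would both satisfy `P`. The connected set `D` lies
    -- inside one of them, contradicting minimality.
    intro T hT hTne hTF
    by_contra! hno
    have hsp := hsplit T (F \ T) (by rwa [Finset.union_sdiff_of_subset hT])
      Finset.disjoint_sdiff fun a ha b hb =>
        hno a ha b (Finset.mem_sdiff.1 hb).1 (Finset.mem_sdiff.1 hb).2
    by_cases hDT : D ⊆ T
    · exact hmin' T hT hTF hDT hsp.1
    · by_cases hDT' : (D ∩ T).Nonempty
      · obtain ⟨a, ha, b, hb, hbT, hab⟩ := hDcon (D ∩ T) Finset.inter_subset_left hDT'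
          fun h => hDT (by rw [← h]; exact Finset.inter_subset_right)
        exact hno a (Finset.mem_inter.1 ha).2 b (hDF hb)
          (fun h => hbT (Finset.mem_inter.2 ⟨hb, h⟩)) hab
      · refine hmin' (F \ T) Finset.sdiff_subset ?_ ?_ hsp.2
        · intro h
          obtain ⟨t, ht⟩ := hTne
          have : t ∈ F \ T := by rw [h]; exact hT ht
          exact (Finset.mem_sdiff.1 this).2 ht
        · intro d hd
          exact Finset.mem_sdiff.2 ⟨hDF hd, fun h => hDT' ⟨d, Finset.mem_inter.2 ⟨hd, h⟩⟩⟩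
  have hchild : ∀ v ∈ F, v ∉ D → ∃ w ∈ F, dir v w := by
    intro v hv hvD
    -- A childless `v` outside `D` leaves `F.erase v` ancestral in `F`, again contradicting
    -- minimality.
    by_contra! hno
    refine hmin' (F.erase v) (Finset.erase_subset _ _) ?_ ?_
      (hanc F _ hPF (Finset.erase_subset _ _) ?_)
    · exact Finset.erase_ne_self.2 hv
    · exact fun d hd => Finset.mem_erase.2 ⟨fun h => hvD (h ▸ hd), hDF hd⟩
    · intro b hb a ha hab
      refine Finset.mem_erase.2 ⟨?_, ha⟩
      rintro rfl
      exact hno b (Finset.mem_of_mem_erase hb) hab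
  refine ⟨F, hFV, hDF, hD, hFcon, hDcon, ?_, hAV, fun a ha => (Finset.mem_sdiff.1 (hA ha)).2,
    hDA, hchild, hAY⟩
  by_contra! hFX
  -- If `F` misses `X`, a lowest element of `F \ A` has a child in `F`, necessarily in `A`, and
  -- ancestrality of `A` puts it into `A`. Connectedness of `F` then gives an edge leaving the
  -- component `D` inside `A`.
  have hFA : F ⊆ A := by
    by_contra hFA
    have hne : (F \ A).Nonempty := Finset.sdiff_nonempty.2 hFA
    obtain ⟨v, hv, hvs⟩ := exists_sink hdir hne
    obtain ⟨hvF, hvA⟩ := Finset.mem_sdiff.1 hv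
    obtain ⟨w, hw, hvw⟩ := hchild v hvF fun h => hvA (hDA h)
    by_cases hwA : w ∈ A
    · exact hvA (hAanc w hwA v (Finset.mem_sdiff.2 ⟨hFV hvF, hFX v hvF⟩) hvw)
    · exact hvs w (Finset.mem_sdiff.2 ⟨hw, hwA⟩) hvw
  obtain ⟨a, ha, b, hb, hbD, hab⟩ := hFcon D hDF hD hDneF
  exact hDcl a ha b (hFA hb) hbD hab

end Hedges

/-! ### Without hedges the observed distribution determines the effect. -/

section Soundness

variable {N : Type u} [DecidableEq N] {G : CausalGraph N} {S : N → Type u}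
  [∀ n, Fintype (S n)]

theorem marg_pos {ι : Type*} [Fintype ι] [DecidableEq ι] {S : ι → Type*}
    [∀ i, Fintype (S i)] {A : Finset ι} {F : (∀ i, S i) → ℝ} (hF : ∀ z, 0 < F z)
    (v : ∀ i, S i) : 0 < marg A F v := by
  classical
  unfold marg
  refine Finset.sum_pos' (fun z _ => ?_) ⟨v, Finset.mem_univ v, ?_⟩
  · split_ifs
    · exact (hF z).le
    · exact le_rfl
  · simpa using hF v

namespace BN

theorem kernel_nonneg (M : BN G S) (V C : Finset N) (v : G.Inst S) : 0 ≤ M.kernel V C v := by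
  classical
  unfold kernel marg
  refine Finset.sum_nonneg fun z _ => ?_
  split_ifs
  · exact Finset.prod_nonneg fun n _ => M.factor_nonneg n z
  · exact le_rfl

variable {V W : Finset N} {M₁ M₂ : BN G S}

/-- Two networks have the same, strictly positive kernel of `C`. -/
def Agree (M₁ M₂ : BN G S) (V C : Finset N) : Prop :=
  C ⊆ V ∧ M₁.kernel V C = M₂.kernel V C ∧ ∀ v, 0 < M₁.kernel V C v

theorem Agree.ancestral {C C' : Finset N} (h : Agree M₁ M₂ V C) (hC' : C' ⊆ C)
    (hanc : ∀ b ∈ C', ∀ a ∈ C, G.HiddenPath V a b → a ∈ C') : Agree M₁ M₂ V C' := by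
  obtain ⟨hC, heq, hpos⟩ := h
  refine ⟨hC'.trans hC, ?_, ?_⟩
  · rw [← M₁.marg_kernel_of_ancestral hC hC' hanc, ← M₂.marg_kernel_of_ancestral hC hC' hanc, heq]
  · rw [← M₁.marg_kernel_of_ancestral hC hC' hanc]
    exact marg_pos hpos

theorem hiddenPath_acyclic (G : CausalGraph N) (V : Finset N) (a : N) :
    ¬ Relation.TransGen (G.HiddenPath V) a a := by
  intro h
  refine G.acyclic a ?_
  have := Relation.TransGen.lift' (r := G.HiddenPath V) (p := G.Adj) id (fun _ _ h => h.transGen) _ _ h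
  exact this

/-- Remove a lowest variable `c` of the union, say from `C₂`. The rest is ancestral, so the kernels
of `C₁` agree by induction, and dividing the product formula by this positive kernel gives agreement
on `C₂`. -/
theorem Agree.split (hW₁ : M₁.Functional W) (hW₂ : M₂.Functional W) {C₁ C₂ : Finset N}
    (h : Agree M₁ M₂ V (C₁ ∪ C₂)) (hd : Disjoint C₁ C₂)
    (hbi : ∀ a ∈ C₁, ∀ b ∈ C₂,
      ¬ ∃ h, h ∉ V ∧ h ∉ W ∧ G.HiddenPath V h a ∧ G.HiddenPath V h b) :
    Agree M₁ M₂ V C₁ ∧ Agree M₁ M₂ V C₂ := by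
  classical
  induction hk : (C₁ ∪ C₂).card using Nat.strong_induction_on generalizing C₁ C₂ with
  | _ k ih =>
  have step : ∀ C₁ C₂ : Finset N, Agree M₁ M₂ V (C₁ ∪ C₂) → Disjoint C₁ C₂ →
      (∀ a ∈ C₁, ∀ b ∈ C₂,
        ¬ ∃ h, h ∉ V ∧ h ∉ W ∧ G.HiddenPath V h a ∧ G.HiddenPath V h b) →
      (C₁ ∪ C₂).card = k → ∀ c ∈ C₂, (∀ m ∈ C₁ ∪ C₂, ¬ G.HiddenPath V c m) →
      Agree M₁ M₂ V C₁ ∧ Agree M₁ M₂ V C₂ := by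
    intro C₁ C₂ h hd hbi hk c hc hsink
    have hcC₁ : c ∉ C₁ := Finset.disjoint_right.1 hd hc
    have herase : C₁ ∪ C₂.erase c = (C₁ ∪ C₂).erase c := by
      rw [Finset.erase_union_distrib, Finset.erase_eq_of_notMem hcC₁]
    have h' : Agree M₁ M₂ V (C₁ ∪ C₂.erase c) := by
      refine h.ancestral (herase ▸ Finset.erase_subset _ _) fun b hb a ha hab => ?_
      rw [herase] at hb ⊢
      refine Finset.mem_erase.2 ⟨?_, ha⟩
      rintro rfl
      exact hsink b (Finset.mem_of_mem_erase hb) hab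
    have h1 : Agree M₁ M₂ V C₁ := by
      refine (ih _ ?_ h' (hd.mono_right (Finset.erase_subset _ _))
        (fun a ha b hb => hbi a ha b (Finset.mem_of_mem_erase hb)) rfl).1
      rw [herase, ← hk]
      exact Finset.card_erase_lt_of_mem (Finset.mem_union_right _ hc)
    refine ⟨h1, Finset.subset_union_right.trans h.1, ?_, ?_⟩
    · funext v
      have e1 := M₁.kernel_union hW₁ h1.1 (Finset.subset_union_right.trans h.1) hd hbi v
      have e2 := M₂.kernel_union hW₂ h1.1 (Finset.subset_union_right.trans h.1) hd hbi v
      rw [← h.2.1, ← h1.2.1, e1] at e2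
      exact mul_left_cancel₀ (h1.2.2 v).ne' e2
    · intro v
      have e1 := M₁.kernel_union hW₁ h1.1 (Finset.subset_union_right.trans h.1) hd hbi v
      have := h.2.2 v
      rw [e1] at this
      exact pos_of_mul_pos_right this (M₁.kernel_nonneg V C₁ v)
  by_cases hne : (C₁ ∪ C₂).Nonempty
  · obtain ⟨c, hc, hsink⟩ := exists_sink (hiddenPath_acyclic G V) hne
    rcases Finset.mem_union.1 hc with hc | hc
    · rw [Finset.union_comm] at h hk hsink
      refine (step C₂ C₁ h hd.symm (fun a ha b hb => ?_) hk c hc hsink).symm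
      rintro ⟨x, h1, h2, h3, h4⟩
      exact hbi b hb a ha ⟨x, h1, h2, h4, h3⟩
    · exact step C₁ C₂ h hd hbi hk c hc hsink
  · rw [Finset.not_nonempty_iff_eq_empty, Finset.union_eq_empty] at hne
    obtain ⟨rfl, rfl⟩ := hne
    exact ⟨h, h⟩

/-- Soundness: without hedges, the distribution of `V` determines the causal effect. -/
theorem effect_eq_of_no_hedge (hW₁ : M₁.Functional W) (hW₂ : M₂.Functional W) {X Y : Finset N}
    (hX : X ⊆ V) (hY : Y ⊆ V) {bi : N → N → Prop} (hsymm : ∀ a b, bi a b → bi b a)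
    (hbi : ∀ a ∈ V, ∀ b ∈ V, a ≠ b →
      (∃ h, h ∉ V ∧ h ∉ W ∧ G.HiddenPath V h a ∧ G.HiddenPath V h b) → bi a b)
    (hno : ∀ F D A, ¬ IsHedge (G.HiddenPath V) bi V X Y F D A)
    (heq : ∀ v, M₁.prob V v = M₂.prob V v) (hpos : ∀ v, 0 < M₁.prob V v) (x y : G.Inst S) :
    M₁.effect X x Y y = M₂.effect X x Y y := by
  classical
  have hsep : ∀ C₁ C₂ : Finset N, C₁ ⊆ V → C₂ ⊆ V → Disjoint C₁ C₂ →
      (∀ a ∈ C₁, ∀ b ∈ C₂, ¬ bi a b) → ∀ a ∈ C₁, ∀ b ∈ C₂,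
        ¬ ∃ h, h ∉ V ∧ h ∉ W ∧ G.HiddenPath V h a ∧ G.HiddenPath V h b :=
    fun C₁ C₂ h1 h2 hd h a ha b hb hh => h a ha b hb
      (hbi a (h1 ha) b (h2 hb) (fun e => Finset.disjoint_left.1 hd ha (e ▸ hb)) hh)
  have hV : Agree M₁ M₂ V V := by
    refine ⟨Finset.Subset.refl V, funext fun v => ?_, fun v => ?_⟩
    · rw [← prob_eq_kernel, ← prob_eq_kernel, heq]
    · rw [← prob_eq_kernel]; exact hpos v
  obtain ⟨A, hAV, hYA, hAanc, hAY⟩ :=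
    exists_ancestral_hull (dir := G.HiddenPath V) (X := X) hY
  have hcomp : ∀ D ⊆ A, D.Nonempty → (∀ a ∈ D, ∀ b ∈ A, b ∉ D → ¬ bi a b) →
      ConnectedOn bi D → Agree M₁ M₂ V D := by
    intro D hDA hD hDcl hDcon
    by_contra hPD
    obtain ⟨F, hF⟩ := exists_isHedge_of_not (P := Agree M₁ M₂ V) (hiddenPath_acyclic G V) hsymm
      (fun C h => h.1) hV (fun C C' h => h.ancestral)
      (fun C₁ C₂ h hd hb => Agree.split hW₁ hW₂ h hd (hsep C₁ C₂
        (Finset.subset_union_left.trans h.1) (Finset.subset_union_right.trans h.1) hd hb))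
      hAV hAanc hAY hDA hD hDcl hDcon hPD
    exact hno F D A hF
  have hAV' : A ⊆ V := hAV.trans Finset.sdiff_subset
  -- The kernel of `A` is the product of the kernels of its bidirected components, which are split
  -- off one at a time.
  have hall : ∀ k, ∀ B ⊆ A, B.card = k → (∀ a ∈ B, ∀ b ∈ A, b ∉ B → ¬ bi a b) →
      M₁.kernel V B = M₂.kernel V B := by
    intro k
    induction k using Nat.strong_induction_on with
    | _ k ih =>
    intro B hBA hk hBcl
    by_cases hB : B.Nonempty
    · obtain ⟨D, hDB, hD, hDcl, hDcon⟩ := exists_component hB hsymm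
      have hDA := hDB.trans hBA
      have hDcl' : ∀ a ∈ D, ∀ b ∈ A, b ∉ D → ¬ bi a b := by
        intro a ha b hb hbD
        by_cases hbB : b ∈ B
        · exact hDcl a ha b hbB hbD
        · exact hBcl a (hDB ha) b hb hbB
      have hagree := hcomp D hDA hD hDcl' hDcon
      have hrest : M₁.kernel V (B \ D) = M₂.kernel V (B \ D) := by
        refine ih (B \ D).card ?_ (B \ D) (Finset.sdiff_subset.trans hBA) rfl ?_
        · rw [← hk]
          exact Finset.card_lt_card (Finset.sdiff_ssubset hDB hD)
        · intro a ha b hb hbn hab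
          obtain ⟨haB, haD⟩ := Finset.mem_sdiff.1 ha
          by_cases hbB : b ∈ B
          · have hbD : b ∈ D := by
              by_contra h
              exact hbn (Finset.mem_sdiff.2 ⟨hbB, h⟩)
            exact hDcl b hbD a haB haD (hsymm _ _ hab)
          · exact hBcl a haB b hb hbB hab
      have hs := hsep D (B \ D) (hDA.trans hAV') ((Finset.sdiff_subset.trans hBA).trans hAV')
        Finset.disjoint_sdiff fun a ha b hb =>
          hDcl a ha b (Finset.mem_sdiff.1 hb).1 (Finset.mem_sdiff.1 hb).2
      funext v
      rw [← Finset.union_sdiff_of_subset hDB,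
        M₁.kernel_union hW₁ (hDA.trans hAV') ((Finset.sdiff_subset.trans hBA).trans hAV')
          Finset.disjoint_sdiff hs,
        M₂.kernel_union hW₂ (hDA.trans hAV') ((Finset.sdiff_subset.trans hBA).trans hAV')
          Finset.disjoint_sdiff hs, hagree.2.1, hrest]
    · rw [Finset.not_nonempty_iff_eq_empty] at hB
      rw [hB, kernel_empty, kernel_empty]
  have hA : M₁.kernel V A = M₂.kernel V A :=
    hall A.card A (Finset.Subset.refl A) rfl fun _ _ _ h h' => absurd h h'
  -- If `x` and `y` are compatible on `X ∩ Y`, they combine to one instantiation; otherwise both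
  -- effects vanish.
  by_cases hxy : ∀ n : G.verts, (n : N) ∈ X → (n : N) ∈ Y → x n = y n
  · have hvx : ∀ n : G.verts, (n : N) ∈ X →
        (fun n : G.verts => if (n : N) ∈ X then x n else y n) n = x n := by
      intro n hn
      simp [hn]
    have hvy : ∀ n : G.verts, (n : N) ∈ Y →
        (fun n : G.verts => if (n : N) ∈ X then x n else y n) n = y n := by
      intro n hn
      by_cases h : (n : N) ∈ X
      · simp [h, hxy n h hn]
      · simp [h]
    rw [M₁.effect_eq_marg_kernel hX hY hAV hYA hAanc hvx hvy,
      M₂.effect_eq_marg_kernel hX hY hAV hYA hAanc hvx hvy, hA]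
  · rw [effect_eq_sum, effect_eq_sum]
    refine Finset.sum_congr rfl fun z _ => ?_
    have hn : ¬ ((∀ n : G.verts, (n : N) ∈ Y → z n = y n) ∧
        ∀ n : G.verts, (n : N) ∈ X → z n = x n) := by
      rintro ⟨h1, h2⟩
      exact hxy fun n hnX hnY => (h2 n hnX).symm.trans (h1 n hnY)
    rw [if_neg hn, if_neg hn]

end BN

end Soundness

end CausalID

namespace CausalID

/-! ### Sign characters and their orthogonality. -/

section Characters

/-- A sign, as a real number. -/
noncomputable def sg : ℤˣ →* ℝ :=
  (Int.castRingHom ℝ).toMonoidHom.comp (Units.coeHom ℤ)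

@[simp]
theorem sg_neg_one : sg (-1) = -1 := by
  simp [sg]

theorem sg_eq (s : ℤˣ) : sg s = 1 ∨ sg s = -1 := by
  rcases Int.units_eq_one_or s with rfl | rfl
  · exact .inl (map_one _)
  · exact .inr sg_neg_one

theorem sg_eq_one_iff {s : ℤˣ} : sg s = 1 ↔ s = 1 := by
  rcases Int.units_eq_one_or s with rfl | rfl
  · simp
  · rw [sg_neg_one]
    constructor
    · intro h; norm_num at h
    · intro h; exact absurd h (by decide)

theorem abs_mul_sg_le {a : ℝ} (ha : |a| ≤ 1) (s : ℤˣ) : |a * sg s| ≤ 1 := by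
  rcases sg_eq s with h | h <;> simp [h, ha]

/-- Expanding the product gives one character for each subset `T`; by orthogonality only the
characters trivial on `K` survive. -/
theorem sum_subgroup_sg_mul_prod {Ω κ : Type*} [CommGroup Ω] [Fintype Ω] (K : Subgroup Ω)
    [DecidablePred (· ∈ K)] (φ : Ω →* ℤˣ) (I : Finset κ) (a : κ → ℝ) (χ : κ → Ω →* ℤˣ)
    [∀ T : Finset κ, Decidable (∀ k ∈ K, φ k * ∏ i ∈ T, χ i k = 1)] :
    ∑ z, (if z ∈ K then sg (φ z) * ∏ i ∈ I, (1 + a i * sg (χ i z)) else 0) =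
      Fintype.card K * ∑ T ∈ I.powerset,
        if ∀ k ∈ K, φ k * ∏ i ∈ T, χ i k = 1 then ∏ i ∈ T, a i else 0 := by
  classical
  have h1 : ∑ z, (if z ∈ K then sg (φ z) * ∏ i ∈ I, (1 + a i * sg (χ i z)) else 0) =
      ∑ k : K, sg (φ k) * ∏ i ∈ I, (1 + a i * sg (χ i k)) := by
    rw [← Finset.sum_filter]
    exact Finset.sum_subtype _ (by simp) _
  rw [h1]
  simp only [Finset.prod_one_add, Finset.mul_sum]
  rw [Finset.sum_comm]
  refine Finset.sum_congr rfl fun T _ => ?_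
  let f : K →* ℝ := sg.comp ((φ * ∏ i ∈ T, χ i).comp K.subtype)
  have hf : ∀ k : K, sg (φ k) * ∏ i ∈ T, (a i * sg (χ i k)) = (∏ i ∈ T, a i) * f k := by
    intro k
    simp only [f, Finset.prod_mul_distrib, MonoidHom.comp_apply, MonoidHom.mul_apply,
      MonoidHom.finsetProd_apply, map_mul, map_prod, Subgroup.subtype_apply]
    ring
  simp only [hf, ← Finset.mul_sum]
  rw [sum_hom_units f]
  have hiff : f = 1 ↔ ∀ k ∈ K, φ k * ∏ i ∈ T, χ i k = 1 := by
    rw [MonoidHom.ext_iff]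
    simp only [f, MonoidHom.comp_apply, MonoidHom.one_apply, sg_eq_one_iff, Subtype.forall,
      MonoidHom.mul_apply, MonoidHom.finsetProd_apply, Subgroup.subtype_apply]
  by_cases h : f = 1
  · rw [if_pos h, if_pos (hiff.1 h)]
    ring
  · rw [if_neg h, if_neg (fun h' => h (hiff.2 h'))]
    simp

end Characters

theorem BN.prob_eq_sum_of_equiv {N : Type u} [DecidableEq N] {G : CausalGraph N} {S : N → Type u}
    [∀ n, Fintype (S n)] (M : BN G S) (e : G.Inst S ≃ G.Inst S) {A : Finset N} {w : G.Inst S}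
    {F : G.Inst S → ℝ}
    (h₁ : ∀ k, (∀ n : G.verts, (n : N) ∈ A → e k n = w n) → ∏ n, M.factor n (e k) = F k)
    (h₂ : ∀ k, (¬ ∀ n : G.verts, (n : N) ∈ A → e k n = w n) → F k = 0) :
    M.prob A w = ∑ k, F k := by
  classical
  rw [BN.prob_eq_sum, ← Equiv.sum_comp e]
  refine Finset.sum_congr rfl fun k _ => ?_
  split_ifs with h
  · exact h₁ k h
  · exact (h₂ k h).symm

/-! ### Networks on the projection with noisy parity equations, and their Fourier expansions. -/

section SignModel

variable {N : Type u} [DecidableEq N]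

/-- Pairs of signs. -/
abbrev Signs : Type u := ULift.{u} (ℤˣ × ℤˣ)

variable (H : CausalGraph N) (V : Finset N)

/-- Assignments of two signs to each variable of the projection. -/
abbrev Config : Type u := (H.project V).verts → Signs.{u}

/-- The first sign of a variable. -/
noncomputable def bit₁ (m : N ⊕ Sym2 N) : Config H V →* ℤˣ :=
  open Classical in
  if h : m ∈ (H.project V).verts then
    { toFun := fun z => (z ⟨m, h⟩).down.1
      map_one' := rfl
      map_mul' := fun _ _ => rfl }
  else 1

/-- The second sign of a variable. -/
noncomputable def bit₂ (m : N ⊕ Sym2 N) : Config H V →* ℤˣ :=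
  open Classical in
  if h : m ∈ (H.project V).verts then
    { toFun := fun z => (z ⟨m, h⟩).down.2
      map_one' := rfl
      map_mul' := fun _ _ => rfl }
  else 1

variable {H V}

theorem bit₁_apply {m : N ⊕ Sym2 N} (h : m ∈ (H.project V).verts) (z : Config H V) :
    bit₁ H V m z = (z ⟨m, h⟩).down.1 := by
  simp [bit₁, h]

theorem bit₂_apply {m : N ⊕ Sym2 N} (h : m ∈ (H.project V).verts) (z : Config H V) :
    bit₂ H V m z = (z ⟨m, h⟩).down.2 := by
  simp [bit₂, h]

theorem bit₁_congr {m : N ⊕ Sym2 N} {z z' : Config H V}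
    (h : ∀ hm : m ∈ (H.project V).verts, z ⟨m, hm⟩ = z' ⟨m, hm⟩) :
    bit₁ H V m z = bit₁ H V m z' := by
  by_cases hm : m ∈ (H.project V).verts
  · rw [bit₁_apply hm, bit₁_apply hm, h hm]
  · simp [bit₁, hm]

theorem bit₂_congr {m : N ⊕ Sym2 N} {z z' : Config H V}
    (h : ∀ hm : m ∈ (H.project V).verts, z ⟨m, hm⟩ = z' ⟨m, hm⟩) :
    bit₂ H V m z = bit₂ H V m z' := by
  by_cases hm : m ∈ (H.project V).verts
  · rw [bit₂_apply hm, bit₂_apply hm, h hm]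
  · simp [bit₂, hm]

theorem bit₁_mulSingle {m : N ⊕ Sym2 N} (n : (H.project V).verts) (s : Signs.{u}) :
    bit₁ H V m (Pi.mulSingle n s) = if m = n then s.down.1 else 1 := by
  by_cases hm : m = n
  · subst hm
    rw [bit₁_apply n.2]
    simp
  · rw [if_neg hm, bit₁_congr (z' := 1), map_one]
    intro h
    exact Pi.mulSingle_eq_of_ne (fun e => hm (congrArg Subtype.val e)) _

theorem bit₂_mulSingle {m : N ⊕ Sym2 N} (n : (H.project V).verts) (s : Signs.{u}) :
    bit₂ H V m (Pi.mulSingle n s) = if m = n then s.down.2 else 1 := by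
  by_cases hm : m = n
  · subst hm
    rw [bit₂_apply n.2]
    simp
  · rw [if_neg hm, bit₂_congr (z' := 1), map_one]
    intro h
    exact Pi.mulSingle_eq_of_ne (fun e => hm (congrArg Subtype.val e)) _

/-- The equations of a network in which each observed variable `v` carries two signs: the
first is a noisy copy of `β v`, with correlation `δ v`; the second is a noisy copy of `γ v`,
or of `γ v` times the first sign if `v ∈ D`, with correlation `ε v`. The signs of hidden
variables are uniformly distributed. -/
structure SignEquations (H : CausalGraph N) (V D : Finset N) where
  β : N → Config H V →* ℤˣ
  γ : N → Config H V →* ℤˣ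
  δ : N → ℝ
  ε : N → ℝ
  β_congr : ∀ v, ∀ z z' : Config H V, (∀ p : (H.project V).verts,
    (H.project V).Adj p (.inl v) → z p = z' p) → β v z = β v z'
  γ_congr : ∀ v, ∀ z z' : Config H V, (∀ p : (H.project V).verts,
    (H.project V).Adj p (.inl v) → z p = z' p) → γ v z = γ v z'
  δ_le : ∀ v, |δ v| ≤ 1
  ε_le : ∀ v, |ε v| ≤ 1

namespace SignEquations

variable {D : Finset N} (E : SignEquations H V D)

/-- The first sign of `v` relative to its prediction. -/
noncomputable def χ (v : N) : Config H V →* ℤˣ := bit₁ H V (.inl v) * E.β v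

/-- The second sign of `v` relative to its prediction. -/
noncomputable def ρ (v : N) : Config H V →* ℤˣ :=
  bit₂ H V (.inl v) * (if v ∈ D then bit₁ H V (.inl v) else 1) * E.γ v

/-- The factors of the network with equations `E`. -/
noncomputable def fac : N ⊕ Sym2 N → Config H V → ℝ
  | .inl v, z => 1 / 4 * ((1 + E.δ v * sg (E.χ v z)) * (1 + E.ε v * sg (E.ρ v z)))
  | .inr _, _ => 1 / 4

theorem χ_congr {v : N} {z z' : Config H V}
    (hv : ∀ hm : Sum.inl v ∈ (H.project V).verts, z ⟨.inl v, hm⟩ = z' ⟨.inl v, hm⟩)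
    (hp : ∀ p : (H.project V).verts, (H.project V).Adj p (.inl v) → z p = z' p) :
    E.χ v z = E.χ v z' := by
  simp only [χ, MonoidHom.mul_apply, bit₁_congr hv, E.β_congr v z z' hp]

theorem ρ_congr {v : N} {z z' : Config H V}
    (hv : ∀ hm : Sum.inl v ∈ (H.project V).verts, z ⟨.inl v, hm⟩ = z' ⟨.inl v, hm⟩)
    (hp : ∀ p : (H.project V).verts, (H.project V).Adj p (.inl v) → z p = z' p) :
    E.ρ v z = E.ρ v z' := by
  simp only [ρ, MonoidHom.mul_apply, bit₂_congr hv, E.γ_congr v z z' hp]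
  split_ifs
  · rw [bit₁_congr hv]
  · rfl

theorem one_add_χ_nonneg (v : N) (z : Config H V) : 0 ≤ 1 + E.δ v * sg (E.χ v z) := by
  have := (abs_le.1 (abs_mul_sg_le (E.δ_le v) (E.χ v z))).1
  linarith

theorem one_add_ρ_nonneg (v : N) (z : Config H V) : 0 ≤ 1 + E.ε v * sg (E.ρ v z) := by
  have := (abs_le.1 (abs_mul_sg_le (E.ε_le v) (E.ρ v z))).1
  linarith

theorem fac_nonneg (n : N ⊕ Sym2 N) (z : Config H V) : 0 ≤ E.fac n z := by
  rcases n with v | e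
  · exact mul_nonneg (by norm_num) (mul_nonneg (E.one_add_χ_nonneg v z) (E.one_add_ρ_nonneg v z))
  · norm_num [fac]

theorem sum_signs (f : Signs.{u} → ℝ) : ∑ s, f s =
    f ⟨1, 1⟩ + f ⟨1, -1⟩ + (f ⟨-1, 1⟩ + f ⟨-1, -1⟩) := by
  rw [← Equiv.sum_comp Equiv.ulift.symm, Fintype.sum_prod_type]
  simp only [UnitsInt.univ]
  rw [Finset.sum_pair (by decide), Finset.sum_pair (by decide), Finset.sum_pair (by decide)]
  rfl

/-- For an observed variable, summing over the second sign removes the `ε` term even when the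
equation contains the first sign; summing over the first sign then removes the `δ` term. -/
theorem sum_fac_update (n : (H.project V).verts) (z : Config H V) :
    ∑ s, E.fac n (Function.update z n s) = 1 := by
  obtain ⟨v | e, hn⟩ := n
  · rw [sum_signs]
    have hp : ∀ s (p : (H.project V).verts), (H.project V).Adj p (.inl v) →
        Function.update z ⟨.inl v, hn⟩ s p = z p := by
      intro s p hp
      refine Function.update_of_ne ?_ _ _
      rintro rfl
      exact (H.project V).acyclic _ (.single hp)
    have hβ : ∀ s, E.β v (Function.update z ⟨.inl v, hn⟩ s) = E.β v z :=
      fun s => E.β_congr v _ _ (hp s)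
    have hγ : ∀ s, E.γ v (Function.update z ⟨.inl v, hn⟩ s) = E.γ v z :=
      fun s => E.γ_congr v _ _ (hp s)
    by_cases hD : v ∈ D
    · simp only [fac, χ, ρ, MonoidHom.mul_apply, hβ, hγ, if_pos hD, bit₁_apply hn, bit₂_apply hn,
        Function.update_self, map_mul, sg_neg_one, map_one]
      ring
    · simp only [fac, χ, ρ, MonoidHom.mul_apply, hβ, hγ, if_neg hD, bit₁_apply hn, bit₂_apply hn,
        Function.update_self, map_mul, sg_neg_one, map_one, MonoidHom.one_apply]
      ring
  · rw [sum_signs]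
    norm_num [fac]

/-- The network with equations `E`. -/
noncomputable def toBN : BN (H.project V) fun _ => Signs.{u} :=
  BN.ofFactors (fun n z => E.fac n z) (fun n z => E.fac_nonneg n z) E.sum_fac_update

theorem factor_toBN (n : (H.project V).verts) (z : Config H V) :
    E.toBN.factor n z = E.fac n z := by
  refine BN.factor_ofFactors (S := fun _ => Signs.{u}) ?_ n z
  rintro ⟨v | e, hn⟩ z z' h hp
  · simp only [fac]
    rw [E.χ_congr (fun _ => h) hp, E.ρ_congr (fun _ => h) hp]
  · rfl

theorem prod_verts_project (g : N ⊕ Sym2 N → ℝ) : ∏ n : (H.project V).verts, g n =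
    (∏ v ∈ V, g (.inl v)) * ∏ e ∈ H.bidirected V, g (.inr e) := by
  rw [Finset.prod_coe_sort]
  exact Finset.prod_disjSum _ _ _

/-- The configurations in which the variables of `A` have the signs `1`. -/
def trivialOn (H : CausalGraph N) (V A : Finset N) : Subgroup (Config H V) where
  carrier := {z | ∀ n : (H.project V).verts, (n : N ⊕ Sym2 N) ∈ observed A → z n = 1}
  mul_mem' := by
    intro a b ha hb n hn
    rw [Pi.mul_apply, ha n hn, hb n hn, mul_one]
  one_mem' := fun _ _ => rfl
  inv_mem' := by
    intro a ha n hn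
    rw [Pi.inv_apply, ha n hn, inv_one]

theorem mem_trivialOn {A : Finset N} {z : Config H V} : z ∈ trivialOn H V A ↔
    ∀ n : (H.project V).verts, (n : N ⊕ Sym2 N) ∈ observed A → z n = 1 := Iff.rfl

theorem inl_mem_observed {A : Finset N} {a : N} :
    (Sum.inl a : N ⊕ Sym2 N) ∈ observed A ↔ a ∈ A := by
  simp [observed]

theorem inr_notMem_observed {A : Finset N} {e : Sym2 N} :
    (Sum.inr e : N ⊕ Sym2 N) ∉ observed A := by
  simp [observed]

theorem bit₂_eq_one_of_mem {A : Finset N} {a : N} (ha : a ∈ A) {z : Config H V}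
    (hz : z ∈ trivialOn H V A) : bit₂ H V (.inl a) z = 1 := by
  rw [bit₂_congr (z' := 1), map_one]
  exact fun hm => hz _ (inl_mem_observed.2 ha)

open Classical in
/-- Fourier expansion of a causal effect under the intervention that sets all signs to `1`. -/
theorem sum_sg_mul_effect (φ : Config H V →* ℤˣ) (X Y : Finset N)
    (hφ : ∀ z ∈ trivialOn H V Y, φ z = 1) :
    ∃ c : ℝ, 0 < c ∧ ∀ E : SignEquations H V D,
      ∑ y, sg (φ y) * E.toBN.effect (observed X) 1 (observed Y) y =
      c * ∑ T ∈ ((V \ X).disjSum (V \ X)).powerset,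
        if ∀ k ∈ trivialOn H V X, φ k * ∏ i ∈ T, (Sum.elim E.χ E.ρ i) k = 1
        then ∏ i ∈ T, Sum.elim E.δ E.ε i else 0 := by
  set κ : ℝ := ((Fintype.card (trivialOn H V Y) : ℕ) : ℝ) with hκ
  have hκpos : 0 < κ := by
    rw [hκ]
    exact_mod_cast Fintype.card_pos
  set q : ℝ := (1 / 4) ^ (V \ X).card * (1 / 4) ^ (H.bidirected V).card with hq
  have hqpos : 0 < q := by positivity
  -- The constant consists of cardinalities and powers of 1/4 only, so the expansions of two
  -- networks can be compared.
  refine ⟨κ * (q * Fintype.card (trivialOn H V X)), ?_, fun E => ?_⟩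
  · have : (0 : ℝ) < Fintype.card (trivialOn H V X) := by exact_mod_cast Fintype.card_pos
    positivity
  have h1 : ∀ z : Config H V,
      ∑ y : Config H V, (if ∀ n : (H.project V).verts, (n : N ⊕ Sym2 N) ∈ observed Y → z n = y n
        then sg (φ y) else 0) = κ * sg (φ z) := by
    intro z
    -- The `y` that agree with `z` on `Y` form the coset of `trivialOn H V Y` through `z`, on which
    -- `φ` is constant.
    rw [← Equiv.sum_comp (Equiv.mulLeft z)]
    have : ∀ k : Config H V, (if ∀ n : (H.project V).verts, (n : N ⊕ Sym2 N) ∈ observed Y →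
        z n = Equiv.mulLeft z k n then sg (φ (Equiv.mulLeft z k)) else 0) =
        if k ∈ trivialOn H V Y then sg (φ z) else 0 := by
      intro k
      have hiff : (∀ n : (H.project V).verts, (n : N ⊕ Sym2 N) ∈ observed Y →
          z n = Equiv.mulLeft z k n) ↔ k ∈ trivialOn H V Y := by
        rw [mem_trivialOn]
        refine forall₂_congr fun n _ => ?_
        change z n = z n * k n ↔ k n = 1
        rw [left_eq_mul]
      by_cases hk : k ∈ trivialOn H V Y
      · rw [if_pos (hiff.2 hk), if_pos hk, Equiv.coe_mulLeft, map_mul, hφ k hk, mul_one]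
      · rw [if_neg (fun h => hk (hiff.1 h)), if_neg hk]
    simp only [this]
    rw [← Finset.sum_filter, Finset.sum_const, nsmul_eq_mul, hκ, Fintype.card_subtype]
  -- In the disjoint sum the left copy of `V \ X` indexes the first signs and the right copy the
  -- second signs.
  have h2 : ∀ z : Config H V, ∏ n ∈ Finset.univ.filter
      (fun n : (H.project V).verts => (n : N ⊕ Sym2 N) ∉ observed X), E.toBN.factor n z =
      q * ∏ i ∈ (V \ X).disjSum (V \ X),
        (1 + Sum.elim E.δ E.ε i * sg ((Sum.elim E.χ E.ρ i) z)) := by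
    intro z
    rw [Finset.prod_filter]
    simp only [factor_toBN]
    rw [prod_verts_project (fun n => if n ∉ observed X then E.fac n z else 1)]
    simp only [inl_mem_observed, inr_notMem_observed, not_false_eq_true, if_true]
    rw [← Finset.prod_filter, ← Finset.sdiff_eq_filter, Finset.prod_disjSum]
    simp only [fac, Finset.prod_const, Finset.prod_mul_distrib, Sum.elim_inl, Sum.elim_inr, hq]
    ring
  have h3 : ∑ y, sg (φ y) * E.toBN.effect (observed X) 1 (observed Y) y =
      κ * (q * ∑ z, if z ∈ trivialOn H V X then sg (φ z) * ∏ i ∈ (V \ X).disjSum (V \ X),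
        (1 + Sum.elim E.δ E.ε i * sg ((Sum.elim E.χ E.ρ i) z)) else 0) := by
    simp only [BN.effect_eq_sum, h2, Finset.mul_sum]
    rw [Finset.sum_comm]
    refine Finset.sum_congr rfl fun z _ => ?_
    by_cases hz : z ∈ trivialOn H V X
    · rw [if_pos hz]
      have : ∀ y : Config H V, sg (φ y) * (if (∀ n : (H.project V).verts,
          (n : N ⊕ Sym2 N) ∈ observed Y → z n = y n) ∧ (∀ n : (H.project V).verts,
          (n : N ⊕ Sym2 N) ∈ observed X → z n = (1 : Config H V) n) then
          q * ∏ i ∈ (V \ X).disjSum (V \ X),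
            (1 + Sum.elim E.δ E.ε i * sg ((Sum.elim E.χ E.ρ i) z)) else 0) =
          (if ∀ n : (H.project V).verts, (n : N ⊕ Sym2 N) ∈ observed Y → z n = y n
            then sg (φ y) else 0) * (q * ∏ i ∈ (V \ X).disjSum (V \ X),
            (1 + Sum.elim E.δ E.ε i * sg ((Sum.elim E.χ E.ρ i) z))) := by
        intro y
        by_cases hy : ∀ n : (H.project V).verts, (n : N ⊕ Sym2 N) ∈ observed Y → z n = y n
        · rw [if_pos ⟨hy, hz⟩, if_pos hy]
        · rw [if_neg (fun h => hy h.1), if_neg hy]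
          ring
      rw [Finset.sum_congr rfl fun y _ => this y, ← Finset.sum_mul, h1]
      ring
    · rw [if_neg hz, mul_zero, mul_zero]
      refine Finset.sum_eq_zero fun y _ => ?_
      rw [if_neg (fun h => hz h.2), mul_zero]
  rw [h3, sum_subgroup_sg_mul_prod]
  ring

open Classical in
/-- The distribution of the observed variables when `T₀` is the only nonempty set of first signs
that is correlated. -/
theorem prob_toBN {T₀ : Finset N} (hT₀ : T₀ ⊆ V) (hne : T₀.Nonempty)
    (hρ : ∀ v, ∀ k ∈ trivialOn H V V, E.ρ v k = 1)
    (htriv : ∀ k ∈ trivialOn H V V, ∏ v ∈ T₀, E.χ v k = 1)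
    (huniq : ∀ T ⊆ V, T.Nonempty → (∀ v ∈ T, E.δ v ≠ 0) →
      (∀ k ∈ trivialOn H V V, ∏ v ∈ T, E.χ v k = 1) → T = T₀) (w : Config H V) :
    E.toBN.prob (observed V) w = (1 / 4) ^ V.card * (1 / 4) ^ (H.bidirected V).card *
      (∏ v ∈ V, (1 + E.ε v * sg (E.ρ v w))) * (Fintype.card (trivialOn H V V) *
        (1 + (∏ v ∈ T₀, E.δ v) * sg (∏ v ∈ T₀, E.χ v w))) := by
  have hiff : ∀ k : Config H V, (∀ n : (H.project V).verts, (n : N ⊕ Sym2 N) ∈ observed V →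
      Equiv.mulLeft w k n = w n) ↔ k ∈ trivialOn H V V := by
    intro k
    rw [mem_trivialOn]
    refine forall₂_congr fun n _ => ?_
    change w n * k n = w n ↔ k n = 1
    rw [mul_eq_left]
  -- The substitution `z = w * k` lets `k` run over a subgroup. The second-sign factors are constant
  -- in `k` by `hρ`, and the values of `χ` at `w` are absorbed into the coefficients.
  rw [BN.prob_eq_sum_of_equiv (S := fun _ => Signs.{u}) E.toBN (Equiv.mulLeft w) (F := fun k =>
      ((1 / 4) ^ V.card * (1 / 4) ^ (H.bidirected V).card *
        ∏ v ∈ V, (1 + E.ε v * sg (E.ρ v w))) * (if k ∈ trivialOn H V V then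
        sg ((1 : Config H V →* ℤˣ) k) *
        ∏ v ∈ V, (1 + (E.δ v * sg (E.χ v w)) * sg (E.χ v k)) else 0))]
  rotate_left
  · intro k hk
    have hk' := (hiff k).1 hk
    rw [if_pos hk']
    simp only [factor_toBN, Equiv.coe_mulLeft]
    rw [prod_verts_project (fun n => E.fac n (w * k))]
    simp only [fac, Finset.prod_const, Finset.prod_mul_distrib, map_mul, hρ _ k hk', mul_one,
      MonoidHom.one_apply, map_one, one_mul, mul_assoc]
    ring
  · intro k hk
    rw [if_neg (fun h => hk ((hiff k).2 h)), mul_zero]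
  rw [← Finset.mul_sum, sum_subgroup_sg_mul_prod]
  congr 2
  -- By `huniq` only these two subsets have a nonzero term.
  rw [← Finset.sum_subset (s₁ := {∅, T₀})]
  · rw [Finset.sum_pair hne.ne_empty.symm, if_pos (by simp), if_pos (by simpa using htriv)]
    simp [Finset.prod_mul_distrib, map_prod]
  · intro T hT
    rcases Finset.mem_insert.1 hT with rfl | hT
    · simp
    · rw [Finset.mem_singleton.1 hT]
      exact Finset.mem_powerset.2 hT₀
  · intro T hT hT'
    simp only [Finset.mem_insert, Finset.mem_singleton, not_or] at hT'
    by_contra h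
    have hc : ∀ k ∈ trivialOn H V V, (1 : Config H V →* ℤˣ) k * ∏ i ∈ T, E.χ i k = 1 := by
      by_contra hc
      exact h (if_neg hc)
    rw [if_pos hc] at h
    refine hT'.2 (huniq T (Finset.mem_powerset.1 hT) (Finset.nonempty_iff_ne_empty.2 hT'.1) ?_ ?_)
    · intro v hv h0
      exact h (Finset.prod_eq_zero hv (by rw [h0, zero_mul]))
    · intro k hk
      simpa using hc k hk

end SignEquations

end SignModel

end CausalID

namespace CausalID

/-! ### The two sign networks attached to a hedge. -/

section Counterexample

variable {N : Type u} [DecidableEq N] {H : CausalGraph N} {V : Finset N}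

theorem inl_mem_verts {a : N} : (Sum.inl a : N ⊕ Sym2 N) ∈ (H.project V).verts ↔ a ∈ V :=
  Finset.inl_mem_disjSum

theorem inr_mem_verts {e : Sym2 N} :
    (Sum.inr e : N ⊕ Sym2 N) ∈ (H.project V).verts ↔ e ∈ H.bidirected V :=
  Finset.inr_mem_disjSum

/-- The configuration whose only negative sign is the first sign of `n`. -/
def flip₁ (n : (H.project V).verts) : Config H V := Pi.mulSingle n ⟨-1, 1⟩

/-- The configuration whose only negative sign is the second sign of `n`. -/
def flip₂ (n : (H.project V).verts) : Config H V := Pi.mulSingle n ⟨1, -1⟩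

@[simp]
theorem bit₁_flip₁ (m : N ⊕ Sym2 N) (n : (H.project V).verts) :
    bit₁ H V m (flip₁ n) = if m = n then -1 else 1 := bit₁_mulSingle n _

@[simp]
theorem bit₂_flip₁ (m : N ⊕ Sym2 N) (n : (H.project V).verts) :
    bit₂ H V m (flip₁ n) = 1 := by
  rw [flip₁, bit₂_mulSingle, ite_self]

@[simp]
theorem bit₁_flip₂ (m : N ⊕ Sym2 N) (n : (H.project V).verts) :
    bit₁ H V m (flip₂ n) = 1 := by
  rw [flip₂, bit₁_mulSingle, ite_self]

@[simp]
theorem bit₂_flip₂ (m : N ⊕ Sym2 N) (n : (H.project V).verts) :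
    bit₂ H V m (flip₂ n) = if m = n then -1 else 1 := bit₂_mulSingle n _

theorem mulSingle_mem_trivialOn {X : Finset N} {n : (H.project V).verts} {s : Signs.{u}}
    (hn : (n : N ⊕ Sym2 N) ∉ observed X) :
    (Pi.mulSingle n s : Config H V) ∈ SignEquations.trivialOn H V X := by
  intro m hm
  exact Pi.mulSingle_eq_of_ne (by rintro rfl; exact hn hm) _

theorem bit₁_inl_of_trivialOn {z : Config H V} (hz : z ∈ SignEquations.trivialOn H V V) (a : N) :
    bit₁ H V (.inl a) z = 1 := by
  rw [bit₁_congr (z' := 1), map_one]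
  exact fun hm => hz _ (SignEquations.inl_mem_observed.2 (inl_mem_verts.1 hm))

theorem bit₂_inl_of_trivialOn {z : Config H V} (hz : z ∈ SignEquations.trivialOn H V V) (a : N) :
    bit₂ H V (.inl a) z = 1 := by
  rw [bit₂_congr (z' := 1), map_one]
  exact fun hm => hz _ (SignEquations.inl_mem_observed.2 (inl_mem_verts.1 hm))

open Classical in
/-- The bidirected edges at `v` that join two variables of `C`. -/
noncomputable def edgesAt (H : CausalGraph N) (V C : Finset N) (v : N) : Finset (Sym2 N) :=
  (H.bidirected V).filter fun e => v ∈ e ∧ ∀ a ∈ e, a ∈ C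

theorem mem_edgesAt {C : Finset N} {v : N} {e : Sym2 N} :
    e ∈ edgesAt H V C v ↔ e ∈ H.bidirected V ∧ v ∈ e ∧ ∀ a ∈ e, a ∈ C := by
  classical
  unfold edgesAt
  exact Finset.mem_filter

/-- The product of the signs of the bidirected edges at `v` that join two variables of `C`. -/
noncomputable def edgeSign (H : CausalGraph N) (V C : Finset N) (v : N) : Config H V →* ℤˣ :=
  ∏ e ∈ edgesAt H V C v, bit₁ H V (.inr e)

theorem edgeSign_congr {C : Finset N} {v : N} {z z' : Config H V}
    (h : ∀ p : (H.project V).verts, (H.project V).Adj p (.inl v) → z p = z' p) :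
    edgeSign H V C v z = edgeSign H V C v z' := by
  simp only [edgeSign, MonoidHom.finsetProd_apply]
  refine Finset.prod_congr rfl fun e he => bit₁_congr fun hm => h ⟨_, hm⟩ ?_
  have he := mem_edgesAt.1 he
  exact ⟨he.1, he.2.1⟩

theorem not_isDiag_of_mem_bidirected {e : Sym2 N} (he : e ∈ H.bidirected V) : ¬ e.IsDiag := by
  classical
  unfold CausalGraph.bidirected at he
  exact (Finset.mem_filter.1 he).2.1

/-- Every bidirected edge inside `C` is counted at each of its two distinct ends, so its sign is
squared. -/
theorem prod_edgeSign (C : Finset N) : ∏ v ∈ C, edgeSign H V C v = 1 := by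
  classical
  refine MonoidHom.ext fun z => ?_
  simp only [edgeSign, MonoidHom.finsetProd_apply, MonoidHom.one_apply]
  rw [Finset.prod_comm' (t' := (H.bidirected V).filter fun e => ∀ a ∈ e, a ∈ C)
    (s' := fun e => C.filter fun v => v ∈ e)]
  · refine Finset.prod_eq_one fun e he => ?_
    obtain ⟨heV, heC⟩ := Finset.mem_filter.1 he
    rw [Finset.prod_const]
    have hd := not_isDiag_of_mem_bidirected heV
    induction e using Sym2.ind with
    | _ a b =>
    have hab : a ≠ b := by simpa using hd
    have : C.filter (fun v => v ∈ s(a, b)) = {a, b} := by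
      ext v
      simp only [Finset.mem_filter, Sym2.mem_iff, Finset.mem_insert, Finset.mem_singleton]
      constructor
      · exact fun h => h.2
      · intro h
        exact ⟨heC v (by simpa using h), h⟩
    rw [this, Finset.card_pair hab, pow_two, Int.units_mul_self]
  · intro v e
    simp only [mem_edgesAt, Finset.mem_filter]
    tauto

theorem edgeSign_flip₁_inl (C : Finset N) (v a : N) (ha : Sum.inl a ∈ (H.project V).verts) :
    edgeSign H V C v (flip₁ ⟨.inl a, ha⟩) = 1 := by
  simp [edgeSign]

theorem edgeSign_flip₂ (C : Finset N) (v : N) (n : (H.project V).verts) :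
    edgeSign H V C v (flip₂ n) = 1 := by
  simp [edgeSign]

/-- The sign `-1` if `a` and `b` are equal. -/
def negIf (a b : N) : ℤˣ := if a = b then -1 else 1

theorem prod_negIf (T : Finset N) (a : N) :
    ∏ v ∈ T, negIf v a = if a ∈ T then -1 else 1 := by
  simp [negIf, Finset.prod_ite_eq']

theorem edgeSign_flip₁_inr {C : Finset N} (v a b : N)
    (he : Sum.inr s(a, b) ∈ (H.project V).verts) :
    edgeSign H V C v (flip₁ ⟨.inr s(a, b), he⟩) =
      if a ∈ C ∧ b ∈ C then negIf v a * negIf v b else 1 := by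
  classical
  have heV := inr_mem_verts.1 he
  have hab : a ≠ b := by simpa using not_isDiag_of_mem_bidirected heV
  simp only [edgeSign, MonoidHom.finsetProd_apply, bit₁_flip₁, Sum.inr.injEq,
    Finset.prod_ite_eq']
  have hmem : s(a, b) ∈ edgesAt H V C v ↔ (v = a ∨ v = b) ∧ a ∈ C ∧ b ∈ C := by
    simp [mem_edgesAt, heV]
  simp only [hmem, negIf]
  by_cases h : a ∈ C ∧ b ∈ C
  · by_cases h1 : v = a
    · subst h1; simp [h, hab]
    · by_cases h2 : v = b
      · subst h2; simp [h, hab.symm]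
      · simp [h1, h2]
  · simp [h]

/-- The product of the given signs of the variables of `C` that `next` sends to `v`. -/
noncomputable def childSign (C : Finset N) (next : N → N) (b : N → Config H V →* ℤˣ) (v : N) :
    Config H V →* ℤˣ :=
  ∏ w ∈ C.filter fun w => next w = v, b w

theorem prod_childSign {C T : Finset N} {next : N → N} (b : N → Config H V →* ℤˣ)
    (h : ∀ w ∈ C, next w ∈ T) : ∏ v ∈ T, childSign C next b v = ∏ w ∈ C, b w :=
  Finset.prod_fiberwise_of_maps_to h _

/-- The only negative sign is that of `a`, and it is read by `next a` alone. -/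
theorem prod_childSign_apply {C T : Finset N} {next : N → N} (b : N → Config H V →* ℤˣ)
    {z : Config H V} {a : N} (hb : ∀ w, b w z = negIf w a) :
    ∏ v ∈ T, childSign C next b v z = if a ∈ C ∧ next a ∈ T then -1 else 1 := by
  have : ∀ v, childSign C next b v z = if a ∈ C then negIf v (next a) else 1 := by
    intro v
    simp only [childSign, MonoidHom.finsetProd_apply, hb, negIf]
    by_cases h : a ∈ C <;> simp [h, eq_comm]
  simp only [this]
  by_cases h : a ∈ C
  · simp [h, prod_negIf]
  · simp [h]

theorem childSign_eq_one {C : Finset N} {next : N → N} {b : N → Config H V →* ℤˣ}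
    {z : Config H V} (hb : ∀ w, b w z = 1) (v : N) : childSign C next b v z = 1 := by
  simp [childSign, MonoidHom.finsetProd_apply, hb]

theorem childSign_congr {C : Finset N} {next : N → N} {b : N → Config H V →* ℤˣ} {v : N}
    (hnext : ∀ w ∈ C, (H.project V).Adj (.inl w) (.inl (next w)))
    (hb : ∀ w (z z' : Config H V), (∀ hm : Sum.inl w ∈ (H.project V).verts,
      z ⟨.inl w, hm⟩ = z' ⟨.inl w, hm⟩) → b w z = b w z') {z z' : Config H V}
    (h : ∀ p : (H.project V).verts, (H.project V).Adj p (.inl v) → z p = z' p) :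
    childSign C next b v z = childSign C next b v z' := by
  simp only [childSign, MonoidHom.finsetProd_apply]
  refine Finset.prod_congr rfl fun w hw => hb w z z' fun hm => h ⟨_, hm⟩ ?_
  have hw := Finset.mem_filter.1 hw
  have := hnext w hw.1
  rwa [hw.2] at this

variable {X Y F D A : Finset N}

/-- The correlations of the first signs. -/
noncomputable def hedgeδ (F D : Finset N) (v : N) : ℝ :=
  -- The value 1 on `F \ D` makes the products over `F` and over `D` equal, so both networks show
  -- the same correlation; 1/2 on `D` keeps it below 1, for strict positivity.
  if v ∈ D then 1 / 2 else if v ∈ F then 1 else 0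

/-- The correlations of the second signs. -/
noncomputable def hedgeε (A : Finset N) (v : N) : ℝ :=
  -- Nonzero on `A`, so that a signal reaches `Y`, and below 1 for positivity.
  if v ∈ A then 1 / 2 else 0

theorem abs_hedgeδ_le (v : N) : |hedgeδ F D v| ≤ 1 := by
  unfold hedgeδ
  split_ifs <;> norm_num [abs_le]

theorem abs_hedgeε_le (v : N) : |hedgeε A v| ≤ 1 := by
  unfold hedgeε
  split_ifs <;> norm_num [abs_le]

section

variable (H V Y F D A)
variable (nx ny : N → N)
  (hnx : ∀ w ∈ F \ D, (H.project V).Adj (.inl w) (.inl (nx w)))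
  (hny : ∀ w ∈ A \ Y, (H.project V).Adj (.inl w) (.inl (ny w)))

/-- The equations in which the whole of `F` is correlated. -/
noncomputable def hedgeEquations₁ : SignEquations H V D where
  β v := edgeSign H V F v * childSign (F \ D) nx (fun w => bit₁ H V (.inl w)) v
  -- The second signs pass the first signs of `D`, which enter through `ρ`, down the paths in `A` to
  -- `Y`.
  γ v := childSign (A \ Y) ny (fun w => bit₂ H V (.inl w)) v
  δ := hedgeδ F D
  ε := hedgeε A
  β_congr v z z' h := by
    simp only [MonoidHom.mul_apply]
    rw [edgeSign_congr h, childSign_congr hnx (fun w z z' h => bit₁_congr h) h]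
  γ_congr v z z' h := childSign_congr hny (fun w z z' h => bit₂_congr h) h
  δ_le := abs_hedgeδ_le
  ε_le := abs_hedgeε_le

/-- The equations in which the variables of `D` ignore the rest of `F`. -/
noncomputable def hedgeEquations₂ : SignEquations H V D where
  β v := if v ∈ D then edgeSign H V D v else
    edgeSign H V F v * childSign (F \ D) nx (fun w => bit₁ H V (.inl w)) v
  γ v := childSign (A \ Y) ny (fun w => bit₂ H V (.inl w)) v
  δ := hedgeδ F D
  ε := hedgeε A
  β_congr v z z' h := by
    split_ifs
    · exact edgeSign_congr h
    · simp only [MonoidHom.mul_apply]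
      rw [edgeSign_congr h, childSign_congr hnx (fun w z z' h => bit₁_congr h) h]
  γ_congr v z z' h := childSign_congr hny (fun w z z' h => bit₂_congr h) h
  δ_le := abs_hedgeδ_le
  ε_le := abs_hedgeε_le

end

variable {nx ny : N → N}
  {hnx : ∀ w ∈ F \ D, (H.project V).Adj (.inl w) (.inl (nx w))}
  {hny : ∀ w ∈ A \ Y, (H.project V).Adj (.inl w) (.inl (ny w))}

theorem prod_hedgeδ (hDF : D ⊆ F) : ∏ v ∈ F, hedgeδ F D v = ∏ v ∈ D, hedgeδ F D v := by
  symm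
  refine Finset.prod_subset hDF fun v hv hvD => ?_
  simp [hedgeδ, hv, hvD]

theorem prod_hedgeδ_pos_lt (hD : D.Nonempty) :
    0 < ∏ v ∈ D, hedgeδ F D v ∧ ∏ v ∈ D, hedgeδ F D v < 1 := by
  have : ∏ v ∈ D, hedgeδ F D v = (1 / 2) ^ D.card := by
    rw [← Finset.prod_const]
    exact Finset.prod_congr rfl fun v hv => by simp [hedgeδ, hv]
  rw [this]
  exact ⟨by positivity, pow_lt_one₀ (by norm_num) (by norm_num) (Finset.card_pos.2 hD).ne'⟩

theorem subset_of_hedgeδ_ne (hDF : D ⊆ F) {T : Finset N} (h : ∀ v ∈ T, hedgeδ F D v ≠ 0) :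
    T ⊆ F := by
  intro v hv
  by_contra hvF
  have hvD : v ∉ D := fun h => hvF (hDF h)
  exact h v hv (by simp [hedgeδ, hvF, hvD])

/-- The edge signs cancel, and the first sign of each `w ∈ F \ D` occurs twice, at `w` and at `nx
w`. What remains is the same observable parity as in `prod_χ_hedgeEquations₂`. -/
theorem prod_χ_hedgeEquations₁ (hDF : D ⊆ F) (hmaps : ∀ w ∈ F \ D, nx w ∈ F) :
    ∏ v ∈ F, (hedgeEquations₁ H V Y F D A nx ny hnx hny).χ v = ∏ v ∈ D, bit₁ H V (.inl v) := by
  simp only [SignEquations.χ, hedgeEquations₁, Finset.prod_mul_distrib, prod_edgeSign, one_mul,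
    prod_childSign _ hmaps]
  rw [← Finset.prod_sdiff hDF]
  refine MonoidHom.ext fun z => ?_
  simp only [MonoidHom.mul_apply]
  rw [mul_right_comm, Int.units_mul_self, one_mul]

theorem prod_χ_hedgeEquations₂ :
    ∏ v ∈ D, (hedgeEquations₂ H V Y F D A nx ny hnx hny).χ v = ∏ v ∈ D, bit₁ H V (.inl v) := by
  have : ∀ v ∈ D, (hedgeEquations₂ H V Y F D A nx ny hnx hny).χ v =
      bit₁ H V (.inl v) * edgeSign H V D v := by
    intro v hv
    simp [SignEquations.χ, hedgeEquations₂, hv]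
  rw [Finset.prod_congr rfl this, Finset.prod_mul_distrib, prod_edgeSign, mul_one]

theorem prod_χ_flip₁_inr_hedgeEquations₁ {a b : N}
    (he : Sum.inr s(a, b) ∈ (H.project V).verts) (ha : a ∈ F) (hb : b ∈ F) {T : Finset N} :
    ∏ v ∈ T, (hedgeEquations₁ H V Y F D A nx ny hnx hny).χ v (flip₁ ⟨.inr s(a, b), he⟩) =
      (if a ∈ T then -1 else 1) * (if b ∈ T then -1 else 1) := by
  have : ∀ v, (hedgeEquations₁ H V Y F D A nx ny hnx hny).χ v (flip₁ ⟨.inr s(a, b), he⟩) =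
      negIf v a * negIf v b := by
    intro v
    simp only [SignEquations.χ, hedgeEquations₁, MonoidHom.mul_apply, edgeSign_flip₁_inr]
    rw [childSign_eq_one (by simp)]
    simp [ha, hb]
  simp only [this, Finset.prod_mul_distrib, prod_negIf]

theorem flip₁_inr_mem_trivialOn {e : Sym2 N} (he : Sum.inr e ∈ (H.project V).verts)
    {X : Finset N} : flip₁ ⟨.inr e, he⟩ ∈ SignEquations.trivialOn H V X :=
  mulSingle_mem_trivialOn SignEquations.inr_notMem_observed

end Counterexample

end CausalID

/-! ### A hedge precludes identifiability. -/

namespace CausalID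

open SignEquations

variable {N : Type u} [DecidableEq N] {H : CausalGraph N} {V X Y F D A : Finset N} {nx ny : N → N}
  {hnx : ∀ w ∈ F \ D, (H.project V).Adj (.inl w) (.inl (nx w))}
  {hny : ∀ w ∈ A \ Y, (H.project V).Adj (.inl w) (.inl (ny w))}

theorem prod_toLeft_mul_prod_toRight {κ M : Type*} [CommMonoid M] (T : Finset (κ ⊕ κ))
    (f : κ ⊕ κ → M) :
    ∏ i ∈ T, f i = (∏ v ∈ T.toLeft, f (.inl v)) * ∏ v ∈ T.toRight, f (.inr v) := by
  conv_lhs => rw [← Finset.toLeft_disjSum_toRight (u := T)]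
  rw [Finset.prod_disjSum]

theorem hedgeδ_nonneg (v : N) : 0 ≤ hedgeδ F D v := by
  unfold hedgeδ
  split_ifs <;> norm_num

theorem hedgeε_nonneg (v : N) : 0 ≤ hedgeε A v := by
  unfold hedgeε
  split_ifs <;> norm_num

/-- In both cases of `h`, `a` is the only member of `T` whose equation reads the edge: either `a ∉
D`, so members of `D` ignore the edge, or the edge leaves `T` within `D`. -/
theorem prod_χ_flip₁_inr_hedgeEquations₂ {a b : N}
    (he : Sum.inr s(a, b) ∈ (H.project V).verts) (ha : a ∈ F) (hb : b ∈ F) {T : Finset N}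
    (h : a ∉ D ∧ b ∉ T \ D ∨ T ⊆ D ∧ b ∈ D ∧ b ∉ T) (haT : a ∈ T) :
    ∏ v ∈ T, (hedgeEquations₂ H V Y F D A nx ny hnx hny).χ v (flip₁ ⟨.inr s(a, b), he⟩) = -1 := by
  have key : ∀ v ∈ T, (hedgeEquations₂ H V Y F D A nx ny hnx hny).χ v
      (flip₁ ⟨.inr s(a, b), he⟩) = negIf v a := by
    intro v hv
    by_cases hvD : v ∈ D
    · simp only [SignEquations.χ, hedgeEquations₂, MonoidHom.mul_apply, if_pos hvD,
        edgeSign_flip₁_inr, bit₁_flip₁]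
      rcases h with ⟨haD, -⟩ | ⟨hTD, hbD, hbT⟩
      · have : v ≠ a := by
          rintro rfl
          exact haD hvD
        simp [haD, negIf, this]
      · have : v ≠ b := by
          rintro rfl
          exact hbT hv
        simp [hTD haT, hbD, negIf, this]
    · have : v ≠ b := by
        rintro rfl
        rcases h with ⟨-, h⟩ | ⟨-, h, -⟩
        · exact h (Finset.mem_sdiff.2 ⟨hv, hvD⟩)
        · exact hvD h
      simp only [SignEquations.χ, hedgeEquations₂, MonoidHom.mul_apply, if_neg hvD,
        edgeSign_flip₁_inr, bit₁_flip₁]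
      rw [childSign_eq_one (by simp)]
      simp [ha, hb, negIf, this]
  rw [Finset.prod_congr rfl key, prod_negIf, if_pos haT]

/-- The equations of the second signs contain no hidden variable. -/
theorem ρ_eq_one_of_trivialOn {E : SignEquations H V D}
    (hγ : ∀ v, E.γ v = childSign (A \ Y) ny (fun w => bit₂ H V (.inl w)) v) (v : N)
    {k : Config H V} (hk : k ∈ trivialOn H V V) : E.ρ v k = 1 := by
  simp only [SignEquations.ρ, hγ, MonoidHom.mul_apply, bit₂_inl_of_trivialOn hk, one_mul]
  rw [childSign_eq_one (fun w => bit₂_inl_of_trivialOn hk w), mul_one]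
  split_ifs
  · exact bit₁_inl_of_trivialOn hk v
  · rfl

/-- A pair of networks that shows that a hedge precludes identifiability. -/
theorem not_identifiable_of_isHedge
    (h : IsHedge (H.HiddenPath V) (fun a b => s(a, b) ∈ H.bidirected V) V X Y F D A) :
    ¬ Identifiable (H.project V) (observed V) {strictPositivity (observed V)}
      (observed X) (observed Y) := by
  classical
  obtain ⟨d₀, hd₀⟩ := h.D_nonempty
  have : Nonempty N := ⟨d₀⟩
  have hDF := h.D_subset
  have hDA := h.D_subset_A
  have hex₁ : ∀ v, v ∈ F \ D → ∃ w, w ∈ F ∧ H.HiddenPath V v w := fun v hv =>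
    h.child_F v (Finset.mem_sdiff.1 hv).1 (Finset.mem_sdiff.1 hv).2
  have hex₂ : ∀ v, v ∈ A \ Y → ∃ w, w ∈ A ∧ H.HiddenPath V v w := fun v hv =>
    h.child_A v (Finset.mem_sdiff.1 hv).1 (Finset.mem_sdiff.1 hv).2
  choose! nx hnxF hnxH using hex₁
  choose! ny hnyA hnyH using hex₂
  have hnx : ∀ w ∈ F \ D, (H.project V).Adj (.inl w) (.inl (nx w)) := fun w hw =>
    ⟨h.F_subset (Finset.mem_sdiff.1 hw).1, h.F_subset (hnxF w hw), hnxH w hw⟩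
  have hny : ∀ w ∈ A \ Y, (H.project V).Adj (.inl w) (.inl (ny w)) := fun w hw =>
    ⟨h.A_subset (Finset.mem_sdiff.1 hw).1, h.A_subset (hnyA w hw), hnyH w hw⟩
  set E₁ := hedgeEquations₁ H V Y F D A nx ny hnx hny with hE₁
  set E₂ := hedgeEquations₂ H V Y F D A nx ny hnx hny with hE₂
  have hχ₁ : ∏ v ∈ F, E₁.χ v = ∏ v ∈ D, bit₁ H V (.inl v) := prod_χ_hedgeEquations₁ hDF hnxF
  have hχ₂ : ∏ v ∈ D, E₂.χ v = ∏ v ∈ D, bit₁ H V (.inl v) := prod_χ_hedgeEquations₂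
  have hvert : ∀ {a b : N}, s(a, b) ∈ H.bidirected V → Sum.inr s(a, b) ∈ (H.project V).verts :=
    fun he => inr_mem_verts.2 he
  have htriv : ∀ k ∈ trivialOn H V V, ∏ v ∈ D, bit₁ H V (.inl v) k = 1 := fun k hk =>
    Finset.prod_eq_one fun v _ => bit₁_inl_of_trivialOn hk v
  -- the distributions of the observed variables
  have hp₁ := E₁.prob_toBN h.F_subset (h.D_nonempty.mono hDF)
    (fun v k hk => ρ_eq_one_of_trivialOn (fun _ => rfl) v hk)
    (fun k hk => by
      rw [← MonoidHom.finsetProd_apply, hχ₁, MonoidHom.finsetProd_apply, htriv k hk])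
    (by
      intro T _ hTne hδ hT
      have hTF : T ⊆ F := subset_of_hedgeδ_ne hDF hδ
      by_contra hne
      -- A bidirected edge crosses the boundary of `T`; flipping its hidden sign changes the product
      -- over `T`, which therefore averages out.
      obtain ⟨a, ha, b, hb, hbT, hab⟩ := h.F_connected T hTF hTne hne
      have h1 := hT _ (flip₁_inr_mem_trivialOn (hvert hab))
      rw [hE₁, prod_χ_flip₁_inr_hedgeEquations₁ (hvert hab) (hTF ha) hb, if_pos ha,
        if_neg hbT] at h1
      exact absurd h1 (by decide))
  have hp₂ := E₂.prob_toBN (hDF.trans h.F_subset) h.D_nonempty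
    (fun v k hk => ρ_eq_one_of_trivialOn (fun _ => rfl) v hk)
    (fun k hk => by
      rw [← MonoidHom.finsetProd_apply, hχ₂, MonoidHom.finsetProd_apply, htriv k hk])
    (by
      intro T _ hTne hδ hT
      have hTF : T ⊆ F := subset_of_hedgeδ_ne hDF hδ
      have hTD : T ⊆ D := by
        by_contra hTD
        -- The edge may end in `D ∩ T`, but there it is ignored by the second network.
        obtain ⟨a, ha, b, hb, hbT, hab⟩ := h.F_connected (T \ D)
          (Finset.sdiff_subset.trans hTF) (Finset.sdiff_nonempty.2 hTD) (by
            intro he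
            have := hDF hd₀
            rw [← he] at this
            exact (Finset.mem_sdiff.1 this).2 hd₀)
        have h1 := hT _ (flip₁_inr_mem_trivialOn (hvert hab))
        obtain ⟨haT, haD⟩ := Finset.mem_sdiff.1 ha
        rw [hE₂, prod_χ_flip₁_inr_hedgeEquations₂ (hvert hab) (hTF haT) hb
          (.inl ⟨haD, hbT⟩) haT] at h1
        exact absurd h1 (by decide)
      by_contra hne
      obtain ⟨a, ha, b, hb, hbT, hab⟩ := h.D_connected T hTD hTne hne
      have h1 := hT _ (flip₁_inr_mem_trivialOn (hvert hab))
      rw [hE₂, prod_χ_flip₁_inr_hedgeEquations₂ (hvert hab) (hTF ha) (hDF hb)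
        (.inr ⟨hTD, hb, hbT⟩) ha] at h1
      exact absurd h1 (by decide))
  have hδ₁ : ∏ v ∈ F, E₁.δ v = ∏ v ∈ D, hedgeδ F D v := prod_hedgeδ hDF
  have hprob : ∀ w, E₁.toBN.prob (observed V) w = E₂.toBN.prob (observed V) w := by
    intro w
    rw [hp₁, hp₂, hδ₁, ← MonoidHom.finsetProd_apply, ← MonoidHom.finsetProd_apply, hχ₁, hχ₂]
    rfl
  have hpos : ∀ w, 0 < E₂.toBN.prob (observed V) w := by
    intro w
    obtain ⟨h0, h1⟩ := prod_hedgeδ_pos_lt (F := F) h.D_nonempty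
    have hε : ∀ v, 0 < 1 + E₂.ε v * sg (E₂.ρ v w) := by
      intro v
      change 0 < 1 + hedgeε A v * _
      unfold hedgeε
      rcases sg_eq (E₂.ρ v w) with hs | hs <;> rw [hs] <;> split_ifs <;> norm_num
    have hδ : 0 < 1 + (∏ v ∈ D, E₂.δ v) * sg (∏ v ∈ D, E₂.χ v w) := by
      change 0 < 1 + (∏ v ∈ D, hedgeδ F D v) * _
      rcases sg_eq (∏ v ∈ D, E₂.χ v w) with hs | hs <;> rw [hs] <;> linarith
    have hcard : (0 : ℝ) < Fintype.card (trivialOn H V V) := by exact_mod_cast Fintype.card_pos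
    rw [hp₂]
    have := Finset.prod_pos (s := V) fun v _ => hε v
    positivity
  -- the causal effects
  intro hid
  have heff := hid (fun _ => Signs.{u}) E₁.toBN E₂.toBN hprob
    ((BN.satisfies_strictPositivity _ _).2 fun w => (hprob w).symm ▸ hpos w)
    ((BN.satisfies_strictPositivity _ _).2 hpos)
  -- The effects are told apart by the expectation of this parity of second signs in `Y`.
  set φ : Config H V →* ℤˣ := ∏ a ∈ A.filter (· ∈ Y), bit₂ H V (.inl a) with hφ
  obtain ⟨c, hc, hsum⟩ := sum_sg_mul_effect (D := D) φ X Y (by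
    intro z hz
    rw [hφ, MonoidHom.finsetProd_apply]
    exact Finset.prod_eq_one fun a ha => bit₂_eq_one_of_mem (Finset.mem_filter.1 ha).2 hz)
  have hs₁ := hsum E₁
  have hs₂ := hsum E₂
  simp only [heff] at hs₁
  rw [hs₁] at hs₂
  have hs := mul_left_cancel₀ hc.ne' hs₂
  clear hs₁ hs₂ hsum heff hid hpos hprob hp₁ hp₂
  have hAX : A ⊆ V \ X := fun a ha => Finset.mem_sdiff.2 ⟨h.A_subset ha, h.A_avoids a ha⟩
  have hmem : ∀ {a : N}, a ∈ A → (Sum.inl a : N ⊕ Sym2 N) ∈ (H.project V).verts :=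
    fun ha => inl_mem_verts.2 (h.A_subset ha)
  have hX : ∀ {a : N} (ha : a ∈ A) (s : Signs.{u}), (Pi.mulSingle ⟨.inl a, hmem ha⟩ s :
      Config H V) ∈ trivialOn H V X :=
    fun ha s => mulSingle_mem_trivialOn fun h' => h.A_avoids _ ha (inl_mem_observed.1 h')
  -- The expansion vanishes for `E₁`. For `E₂` all terms are nonnegative, and the one at `D.disjSum
  -- A` is positive.
  refine absurd hs (ne_of_lt ?_)
  rw [Finset.sum_eq_zero]
  · refine Finset.sum_pos' (fun T _ => ?_) ⟨D.disjSum A, ?_, ?_⟩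
    · split_ifs
      · refine Finset.prod_nonneg fun i _ => ?_
        rcases i with v | v
        · exact hedgeδ_nonneg v
        · exact hedgeε_nonneg v
      · exact le_rfl
    · exact Finset.mem_powerset.2 (Finset.disjSum_mono (hDA.trans hAX) hAX)
    · rw [if_pos]
      · rw [Finset.prod_disjSum]
        refine mul_pos (prod_hedgeδ_pos_lt h.D_nonempty).1 (Finset.prod_pos fun v hv => ?_)
        change 0 < hedgeε A v
        simp [hedgeε, hv]
      · intro k _
        have hρ : ∏ v ∈ A, E₂.ρ v = (∏ v ∈ A, bit₂ H V (.inl v)) *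
            (∏ v ∈ D, bit₁ H V (.inl v)) * ∏ v ∈ A \ Y, bit₂ H V (.inl v) := by
          change ∏ v ∈ A, bit₂ H V (.inl v) * (if v ∈ D then bit₁ H V (.inl v) else 1) *
            childSign (A \ Y) ny (fun w => bit₂ H V (.inl w)) v = _
          rw [Finset.prod_mul_distrib, Finset.prod_mul_distrib, prod_childSign _ hnyA,
            Finset.prod_ite_mem, Finset.inter_eq_right.2 hDA]
        have hAY : (∏ a ∈ A.filter (· ∈ Y), bit₂ H V (.inl a)) * ∏ v ∈ A \ Y, bit₂ H V (.inl v) =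
            ∏ v ∈ A, bit₂ H V (.inl v) := by
          rw [Finset.sdiff_eq_filter, Finset.prod_filter_mul_prod_filter_not]
        rw [Finset.prod_disjSum]
        simp only [Sum.elim_inl, Sum.elim_inr, ← MonoidHom.finsetProd_apply, hχ₂, hρ, ← hAY,
          MonoidHom.mul_apply, hφ]
        generalize (∏ a ∈ A.filter (· ∈ Y), bit₂ H V (.inl a)) k = p
        generalize (∏ a ∈ D, bit₁ H V (.inl a)) k = q
        generalize (∏ a ∈ A \ Y, bit₂ H V (.inl a)) k = r
        calc p * (q * (p * r * q * r)) = (p * p) * (q * q) * (r * r) := by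
              simp only [mul_comm, mul_left_comm]
          _ = 1 := by simp only [Int.units_mul_self, mul_one]
  · intro T hT
    by_contra hne
    have hcond : ∀ k ∈ trivialOn H V X, φ k * ((∏ v ∈ T.toLeft, E₁.χ v k) *
        ∏ v ∈ T.toRight, E₁.ρ v k) = 1 := by
      by_contra hcond
      refine hne (if_neg fun hh => hcond fun k hk => ?_)
      rw [← hh k hk, prod_toLeft_mul_prod_toRight]
      rfl
    have hprod : ∏ i ∈ T, Sum.elim E₁.δ E₁.ε i ≠ 0 := by
      intro h0
      refine hne ?_
      rw [h0, ite_self]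
    have hTδ : T.toLeft ⊆ F := subset_of_hedgeδ_ne hDF fun v hv h0 =>
      hprod (Finset.prod_eq_zero (Finset.mem_toLeft.1 hv) h0)
    have hTX : ∀ v ∈ T.toLeft, v ∉ X := fun v hv => by
      have := Finset.mem_powerset.1 hT (Finset.mem_toLeft.1 hv)
      exact (Finset.mem_sdiff.1 (Finset.inl_mem_disjSum.1 this)).2
    clear hne hprod hs
    have hφ₁ : ∀ n, φ (flip₁ n) = 1 := fun n => by
      simp [hφ, MonoidHom.finsetProd_apply]
    have hρ₁ : ∀ n v, E₁.ρ v (flip₁ n) =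
        if v ∈ D then bit₁ H V (.inl v) (flip₁ n) else 1 := by
      intro n v
      have : childSign (A \ Y) ny (fun w => bit₂ H V (.inl w)) v (flip₁ n) = 1 :=
        childSign_eq_one (by simp) v
      change (bit₂ H V (.inl v) * (if v ∈ D then bit₁ H V (.inl v) else 1) *
        childSign (A \ Y) ny (fun w => bit₂ H V (.inl w)) v) (flip₁ n) = _
      simp only [MonoidHom.mul_apply, this, mul_one, bit₂_flip₁, one_mul]
      split_ifs <;> rfl
    have hχ₃ : ∀ n v, E₁.χ v (flip₂ n) = 1 := by
      intro n v
      change (bit₁ H V (.inl v) * (edgeSign H V F v *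
        childSign (F \ D) nx (fun w => bit₁ H V (.inl w)) v)) (flip₂ n) = 1
      simp only [MonoidHom.mul_apply, bit₁_flip₂, edgeSign_flip₂, one_mul]
      exact childSign_eq_one (by simp) v
    -- At a lowest variable `v` of `A` missing from `T`, flip the second sign. Either `v ∈ Y` and
    -- only `φ` changes, or `ny v` is in `T` and only its `ρ` changes.
    have hAT : A ⊆ T.toRight := by
      by_contra hAT
      obtain ⟨v, hv, hsink⟩ := exists_sink (BN.hiddenPath_acyclic H V)
        (Finset.sdiff_nonempty.2 hAT)
      obtain ⟨hvA, hvT⟩ := Finset.mem_sdiff.1 hv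
      have h1 := hcond _ (hX hvA ⟨1, -1⟩)
      change φ (flip₂ _) * ((∏ i ∈ _, E₁.χ i (flip₂ _)) * ∏ i ∈ _, E₁.ρ i (flip₂ _)) = 1 at h1
      have hρ₂ : ∏ i ∈ T.toRight, E₁.ρ i (flip₂ ⟨.inl v, hmem hvA⟩) =
          if v ∈ A \ Y ∧ ny v ∈ T.toRight then -1 else 1 := by
        have : ∀ i, E₁.ρ i (flip₂ ⟨.inl v, hmem hvA⟩) = negIf i v *
            childSign (A \ Y) ny (fun w => bit₂ H V (.inl w)) i (flip₂ ⟨.inl v, hmem hvA⟩) := by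
          intro i
          change (bit₂ H V (.inl i) * (if i ∈ D then bit₁ H V (.inl i) else 1) *
            childSign (A \ Y) ny (fun w => bit₂ H V (.inl w)) i) (flip₂ _) = _
          simp only [MonoidHom.mul_apply, bit₂_flip₂, Sum.inl.injEq]
          by_cases hiD : i ∈ D <;> simp [negIf, hiD]
        simp only [this, Finset.prod_mul_distrib]
        rw [prod_childSign_apply (a := v) _ (fun w => by simp [negIf]), prod_negIf, if_neg hvT,
          one_mul]
      simp only [hχ₃, Finset.prod_const_one, one_mul, hρ₂] at h1
      have hφ₂ : φ (flip₂ ⟨.inl v, hmem hvA⟩) = if v ∈ Y then -1 else 1 := by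
        rw [hφ, MonoidHom.finsetProd_apply]
        have : ∀ a : N, bit₂ H V (.inl a) (flip₂ ⟨.inl v, hmem hvA⟩) = negIf a v := by
          intro a
          simp [negIf]
        simp only [this, prod_negIf, Finset.mem_filter, hvA, true_and]
      by_cases hvY : v ∈ Y
      · rw [hφ₂, if_pos hvY, if_neg (by simp [hvY])] at h1
        exact absurd h1 (by decide)
      · have hvAY : v ∈ A \ Y := Finset.mem_sdiff.2 ⟨hvA, hvY⟩
        have hnyT : ny v ∈ T.toRight := by
          by_contra hn
          exact hsink _ (Finset.mem_sdiff.2 ⟨hnyA v hvAY, hn⟩) (hnyH v hvAY)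
        rw [hφ₂, if_neg hvY, if_pos ⟨hvAY, hnyT⟩] at h1
        exact absurd h1 (by decide)
    -- If `v ∈ D` is missing, its first sign is seen only by its own `ρ`, because first signs of `D`
    -- are not passed on to other first signs.
    have hDT : D ⊆ T.toLeft := by
      intro v hv
      by_contra hvT
      have hvA := hDA hv
      have h1 := hcond _ (hX hvA ⟨-1, 1⟩)
      change φ (flip₁ _) * ((∏ i ∈ _, E₁.χ i (flip₁ _)) * ∏ i ∈ _, E₁.ρ i (flip₁ _)) = 1 at h1
      have hχ : ∏ i ∈ T.toLeft, E₁.χ i (flip₁ ⟨.inl v, hmem hvA⟩) = 1 := by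
        change ∏ i ∈ T.toLeft, (bit₁ H V (.inl i) * (edgeSign H V F i *
          childSign (F \ D) nx (fun w => bit₁ H V (.inl w)) i)) (flip₁ _) = 1
        simp only [MonoidHom.mul_apply, edgeSign_flip₁_inl, one_mul, Finset.prod_mul_distrib]
        rw [prod_childSign_apply (a := v) _ (fun w => by simp [negIf]), if_neg (by simp [hv])]
        have : ∀ i : N, bit₁ H V (.inl i) (flip₁ ⟨.inl v, hmem hvA⟩) = negIf i v := by
          intro a
          simp [negIf]
        simp only [this, prod_negIf, hvT, if_false, mul_one]
      have hρ : ∏ i ∈ T.toRight, E₁.ρ i (flip₁ ⟨.inl v, hmem hvA⟩) = -1 := by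
        have : ∀ i, E₁.ρ i (flip₁ ⟨.inl v, hmem hvA⟩) = negIf i v := by
          intro i
          rw [hρ₁]
          by_cases hiv : i = v
          · subst hiv
            simp [negIf, hv]
          · simp [negIf, hiv]
        simp only [this, prod_negIf, hAT hvA, if_true]
      rw [hφ₁, hχ, hρ] at h1
      exact absurd h1 (by decide)
    -- The treated `x` cannot be in `T.toLeft`, so this is a nonempty proper subset of `F` and a
    -- bidirected edge crosses its boundary.
    obtain ⟨x, hxF, hxX⟩ := h.meets
    obtain ⟨a, ha, b, hb, hbT, hab⟩ := h.F_connected T.toLeft hTδ ⟨d₀, hDT hd₀⟩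
      (fun he => hTX x (he ▸ hxF) hxX)
    have h1 := hcond _ (flip₁_inr_mem_trivialOn (hvert hab))
    rw [hφ₁, hE₁, prod_χ_flip₁_inr_hedgeEquations₁ (hvert hab) (hTδ ha) hb, ← hE₁, if_pos ha,
      if_neg hbT, Finset.prod_eq_one (fun v _ => by rw [hρ₁]; simp)] at h1
    exact absurd h1 (by decide)

end CausalID

namespace CausalID

/-! ### Simulation of a network on the functional projection by a network on `G`. -/

section Simulation

variable {N : Type u} [DecidableEq N]

/-- For each bidirected edge a hidden variable that generates it, and for each end of a hidden
path a parent through which the path arrives. -/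
structure RelayPlan (G : CausalGraph N) (V W : Finset N) where
  src : Sym2 N → N
  par : N → N → N
  src_spec : ∀ e ∈ (G.elimSet W).bidirected V,
    src e ∉ V ∧ src e ∉ W ∧ ∀ a ∈ e, G.HiddenPath V (src e) a
  par_spec : ∀ r n, G.HiddenPath V r n → G.Adj (par r n) n ∧
    (par r n = r ∨ (par r n ∉ V ∧ G.HiddenPath V r (par r n)))

theorem RelayPlan.nonempty [Nonempty N] (G : CausalGraph N) {V W : Finset N}
    (hWV : Disjoint W V) : Nonempty (RelayPlan G V W) := by
  classical
  have h1 : ∀ e, e ∈ (G.elimSet W).bidirected V →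
      ∃ h, h ∉ V ∧ h ∉ W ∧ ∀ a ∈ e, G.HiddenPath V h a := by
    intro e he
    induction e using Sym2.ind with
    | _ a b =>
    have ha : a ∈ V := CausalGraph.mem_of_mem_bidirected he (Sym2.mem_mk_left a b)
    have hb : b ∈ V := CausalGraph.mem_of_mem_bidirected he (Sym2.mem_mk_right a b)
    obtain ⟨_, h, h1, h2, h3, h4⟩ := (CausalGraph.mem_bidirected_elimSet hWV ha hb).1 he
    refine ⟨h, h1, h2, fun c hc => ?_⟩
    rcases Sym2.mem_iff.1 hc with rfl | rfl
    · exact h3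
    · exact h4
  have h2 : ∀ r n, G.HiddenPath V r n → ∃ p, G.Adj p n ∧
      (p = r ∨ (p ∉ V ∧ G.HiddenPath V r p)) := fun r n h => h.exists_last
  choose! src hsrc using h1
  choose! par hpar using h2
  exact ⟨src, par, hsrc, hpar⟩

variable {G : CausalGraph N} {V W : Finset N} {S' : N ⊕ Sym2 N → Type u}

/-- The states of the simulating network: an observed variable keeps its states, and a hidden one
has the instantiations of the whole projection as states. -/
def SimState (G : CausalGraph N) (V W : Finset N) (S' : N ⊕ Sym2 N → Type u) (n : N) : Type u :=
  -- A hidden variable may have to relay many values at once; a full instantiation has room for all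
  -- of them, and unused components hold a default.
  if n ∈ V then S' (.inl n) else (G.functionalProjection V W).Inst S'

/-- The states of an observed variable. -/
def obsEquiv {n : N} (h : n ∈ V) : SimState G V W S' n ≃ S' (.inl n) :=
  Equiv.cast (if_pos h)

/-- The states of a hidden variable. -/
def hidEquiv {n : N} (h : n ∉ V) :
    SimState G V W S' n ≃ (G.functionalProjection V W).Inst S' :=
  Equiv.cast (if_neg h)

variable [∀ n, Fintype (S' n)] [∀ n, Nonempty (S' n)]

noncomputable instance (n : N) : Fintype (SimState G V W S' n) :=
  if h : n ∈ V then Fintype.ofEquiv _ (obsEquiv h).symm else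
    Fintype.ofEquiv _ (hidEquiv h).symm

instance (n : N) : Nonempty (SimState G V W S' n) := by
  by_cases h : n ∈ V
  · exact (obsEquiv h).nonempty
  · exact (hidEquiv h).nonempty

variable (G V W S') in
/-- A default instantiation of the projection. -/
noncomputable def defaultInst : (G.functionalProjection V W).Inst S' :=
  Classical.arbitrary _

theorem inl_mem_functionalProjection {a : N} :
    (Sum.inl a : N ⊕ Sym2 N) ∈ (G.functionalProjection V W).verts ↔ a ∈ V :=
  inl_mem_verts

theorem inr_mem_functionalProjection {e : Sym2 N} :
    (Sum.inr e : N ⊕ Sym2 N) ∈ (G.functionalProjection V W).verts ↔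
      e ∈ (G.elimSet W).bidirected V :=
  inr_mem_verts

/-- The values of the variables of the projection that the variable `p` makes available. -/
noncomputable def readAt (p : N) (z : G.Inst (SimState G V W S')) :
    (G.functionalProjection V W).Inst S' :=
  if hp : p ∈ G.verts then
    if h : p ∈ V then
      Function.update (defaultInst G V W S') ⟨.inl p, inl_mem_functionalProjection.2 h⟩
        (obsEquiv h (z ⟨p, hp⟩))
    else hidEquiv h (z ⟨p, hp⟩)
  else defaultInst G V W S'

theorem readAt_congr {p : N} {z z' : G.Inst (SimState G V W S')}
    (h : ∀ hp : p ∈ G.verts, z ⟨p, hp⟩ = z' ⟨p, hp⟩) : readAt p z = readAt p z' := by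
  unfold readAt
  split_ifs with hp hV
  · rw [h hp]
  · rw [h hp]
  · rfl

theorem readAt_of_mem {p : N} (hp : p ∈ G.verts) (h : p ∈ V) (z : G.Inst (SimState G V W S')) :
    readAt p z ⟨.inl p, inl_mem_functionalProjection.2 h⟩ = obsEquiv h (z ⟨p, hp⟩) := by
  simp [readAt, hp, h]

theorem readAt_of_notMem {p : N} (hp : p ∈ G.verts) (h : p ∉ V)
    (z : G.Inst (SimState G V W S')) : readAt p z = hidEquiv h (z ⟨p, hp⟩) := by
  simp [readAt, hp, h]

namespace RelayPlan

variable (R : RelayPlan G V W)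

/-- The variable of `G` at which the value of the variable `m` of the projection originates. -/
def root (m : N ⊕ Sym2 N) : N := Sum.elim id R.src m

theorem root_mem (hV : V ⊆ G.verts) (m : (G.functionalProjection V W).verts) :
    R.root m ∈ G.verts := by
  obtain ⟨a | e, hm⟩ := m
  · exact hV (inl_mem_functionalProjection.1 hm)
  · induction e using Sym2.ind with
    | _ a b =>
    exact ((R.src_spec _ (inr_mem_functionalProjection.1 hm)).2.2 a
      (Sym2.mem_mk_left a b)).left_mem

theorem exists_eq_inr {m : (G.functionalProjection V W).verts} (h : R.root m ∉ V) :
    ∃ e, (m : N ⊕ Sym2 N) = .inr e := by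
  obtain ⟨a | e, hm⟩ := m
  · exact absurd (inl_mem_functionalProjection.1 hm) h
  · exact ⟨e, rfl⟩

theorem eq_inl {m : (G.functionalProjection V W).verts} (h : R.root m ∈ V) :
    (m : N ⊕ Sym2 N) = .inl (R.root m) := by
  obtain ⟨a | e, hm⟩ := m
  · rfl
  · exact absurd h (R.src_spec _ (inr_mem_functionalProjection.1 hm)).1

open Classical in
/-- The value of `m` that arrives at `n`. -/
noncomputable def arriving (n : N) (z : G.Inst (SimState G V W S')) :
    (G.functionalProjection V W).Inst S' := fun m =>
  if G.HiddenPath V (R.root m) n then readAt (R.par (R.root m) n) z m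
  else defaultInst G V W S' m

theorem arriving_congr {n : N} {z z' : G.Inst (SimState G V W S')}
    (h : ∀ p : G.verts, G.Adj p n → z p = z' p) : R.arriving n z = R.arriving n z' := by
  funext m
  unfold arriving
  split_ifs with hm
  · rw [readAt_congr fun hp => h ⟨_, hp⟩ (R.par_spec _ _ hm).1]
  · rfl

variable (M' : BN (G.functionalProjection V W) S')

open Classical in
/-- The factor of the component `m` of a hidden variable `n`. -/
noncomputable def hidFactor (n : N) (z : G.Inst (SimState G V W S'))
    (m : (G.functionalProjection V W).verts) (t : (G.functionalProjection V W).Inst S') : ℝ :=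
  -- Randomness enters only at the root of `m`; elsewhere the component is a deterministic copy,
  -- which makes `W` functional.
  if R.root m = n then M'.factor m t else if t m = R.arriving n z m then 1 else 0

open Classical in
/-- The factors of the simulating network. -/
noncomputable def simFactor (n : G.verts) (z : G.Inst (SimState G V W S')) : ℝ :=
  if h : (n : N) ∈ V then
    M'.factor ⟨.inl n, inl_mem_functionalProjection.2 h⟩
      (Function.update (R.arriving n z) ⟨.inl n, inl_mem_functionalProjection.2 h⟩
        (obsEquiv h (z n)))
  else ∏ m, R.hidFactor M' n z m (hidEquiv h (z n))

theorem factor_inr_congr {m : (G.functionalProjection V W).verts} {e : Sym2 N}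
    (hm : (m : N ⊕ Sym2 N) = .inr e) {t t' : (G.functionalProjection V W).Inst S'}
    (h : t m = t' m) : M'.factor m t = M'.factor m t' := by
  refine M'.factor_congr m t t' h fun p hp => ?_
  rw [hm] at hp
  obtain ⟨a | e', hv⟩ := p <;> exact hp.elim

theorem simFactor_nonneg (n : G.verts) (z : G.Inst (SimState G V W S')) :
    0 ≤ R.simFactor M' n z := by
  unfold simFactor
  split_ifs
  · exact M'.factor_nonneg _ _
  · refine Finset.prod_nonneg fun m _ => ?_
    unfold hidFactor
    split_ifs
    · exact M'.factor_nonneg _ _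
    · exact zero_le_one
    · exact le_rfl

theorem simFactor_congr (n : G.verts) (z z' : G.Inst (SimState G V W S')) (hn : z n = z' n)
    (hp : ∀ p : G.verts, G.Adj p n → z p = z' p) :
    R.simFactor M' n z = R.simFactor M' n z' := by
  unfold simFactor hidFactor
  rw [R.arriving_congr hp, hn]

theorem sum_simFactor_update (n : G.verts) (z : G.Inst (SimState G V W S')) :
    ∑ s, R.simFactor M' n (Function.update z n s) = 1 := by
  classical
  have harr : ∀ s, R.arriving n (Function.update z n s) = R.arriving n z := by
    intro s
    refine R.arriving_congr fun p hp => Function.update_of_ne ?_ _ _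
    rintro rfl
    exact G.acyclic _ (.single hp)
  by_cases h : (n : N) ∈ V
  · simp only [simFactor, dif_pos h, harr, Function.update_self]
    rw [Equiv.sum_comp (obsEquiv h) fun s => M'.factor ⟨.inl n, inl_mem_functionalProjection.2 h⟩
      (Function.update (R.arriving n z) ⟨.inl n, inl_mem_functionalProjection.2 h⟩ s)]
    exact M'.sum_factor_update ⟨.inl n, inl_mem_functionalProjection.2 h⟩ (R.arriving n z)
  · simp only [simFactor, dif_neg h, hidFactor, harr, Function.update_self]
    rw [Equiv.sum_comp (hidEquiv h) fun t =>
      ∏ m : (G.functionalProjection V W).verts, if R.root m = n then M'.factor m t else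
      if t m = R.arriving n z m then 1 else 0]
    -- Auxiliary variables are roots of the projection, so each factor depends on one component only
    -- and the sum of products becomes a product of sums.
    let g (m : (G.functionalProjection V W).verts) (a : S' m) : ℝ :=
      if R.root m = n then M'.factor m (Function.update (defaultInst G V W S') m a) else
        if a = R.arriving n z m then 1 else 0
    have hf : ∀ t : (G.functionalProjection V W).Inst S',
        (∏ m : (G.functionalProjection V W).verts, if R.root m = n then M'.factor m t else
          if t m = R.arriving n z m then 1 else 0) = ∏ m, g m (t m) := by
      intro t
      refine Finset.prod_congr rfl fun m _ => ?_
      by_cases hm : R.root m = n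
      · obtain ⟨e, he⟩ := R.exists_eq_inr (m := m) (by rwa [hm])
        simp only [g, if_pos hm]
        exact factor_inr_congr M' he (by simp)
      · simp only [g, if_neg hm]
    have hpi := Finset.prod_univ_sum (fun _ => Finset.univ) g
    rw [Fintype.piFinset_univ] at hpi
    rw [Finset.sum_congr rfl fun t _ => hf t]
    refine hpi.symm.trans ?_
    refine Finset.prod_eq_one fun m _ => ?_
    by_cases hm : R.root m = n
    · simp only [g, if_pos hm]
      exact M'.sum_factor_update _ _
    · simp only [g, if_neg hm]
      simp

/-- The network with causal graph `G` that simulates the network `M'` on the projection. -/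
noncomputable def simBN : BN G (SimState G V W S') :=
  BN.ofFactors (R.simFactor M') (R.simFactor_nonneg M') (R.sum_simFactor_update M')

theorem factor_simBN (n : G.verts) (z : G.Inst (SimState G V W S')) :
    (R.simBN M').factor n z = R.simFactor M' n z :=
  BN.factor_ofFactors (R.simFactor_congr M') n z

theorem functional_simBN (hWV : Disjoint W V) : (R.simBN M').Functional W := by
  classical
  refine BN.functional_ofFactors fun n hn z => ?_
  have hnV : (n : N) ∉ V := Finset.disjoint_left.1 hWV hn
  have h01 : ∀ m, R.hidFactor M' n z m (hidEquiv hnV (z n)) = 0 ∨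
      R.hidFactor M' n z m (hidEquiv hnV (z n)) = 1 := by
    intro m
    have hm : R.root m ≠ n := by
      intro hm
      obtain ⟨e, he⟩ := R.exists_eq_inr (m := m) (by rwa [hm])
      have h1 := R.src_spec e (inr_mem_functionalProjection.1 (he ▸ m.2))
      rw [he] at hm
      have hsrc : R.src e = n := hm
      exact h1.2.1 (by rw [hsrc]; exact hn)
    unfold hidFactor
    rw [if_neg hm]
    split_ifs
    · exact .inr rfl
    · exact .inl rfl
  simp only [simFactor, dif_neg hnV]
  by_cases h : ∃ m, R.hidFactor M' n z m (hidEquiv hnV (z n)) = 0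
  · obtain ⟨m, hm⟩ := h
    exact .inl (Finset.prod_eq_zero (Finset.mem_univ m) hm)
  · push Not at h
    exact .inr (Finset.prod_eq_one fun m _ => (h01 m).resolve_left (h m))

open Classical in
/-- The instantiation of `G` that corresponds to an instantiation of the projection. -/
noncomputable def embed (z' : (G.functionalProjection V W).Inst S') :
    G.Inst (SimState G V W S') := fun n =>
  if h : (n : N) ∈ V then (obsEquiv h).symm (z' ⟨.inl n, inl_mem_functionalProjection.2 h⟩)
  else (hidEquiv h).symm fun m =>
    if R.root m = n ∨ G.HiddenPath V (R.root m) n then z' m else defaultInst G V W S' m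

/-- The instantiation of the projection that an instantiation of `G` contains. -/
noncomputable def restrict (z : G.Inst (SimState G V W S')) :
    (G.functionalProjection V W).Inst S' := fun m => readAt (R.root m) z m

theorem obsEquiv_embed (z' : (G.functionalProjection V W).Inst S') {n : G.verts}
    (h : (n : N) ∈ V) : obsEquiv h (R.embed z' n) =
      z' ⟨.inl n, inl_mem_functionalProjection.2 h⟩ := by
  simp [embed, h]

open Classical in
theorem hidEquiv_embed (z' : (G.functionalProjection V W).Inst S') {n : G.verts}
    (h : (n : N) ∉ V) (m : (G.functionalProjection V W).verts) :
    hidEquiv h (R.embed z' n) m =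
      if R.root m = n ∨ G.HiddenPath V (R.root m) n then z' m else defaultInst G V W S' m := by
  simp [embed, h]

theorem readAt_embed (hV : V ⊆ G.verts) (z' : (G.functionalProjection V W).Inst S') {p : N}
    {m : (G.functionalProjection V W).verts}
    (h : p = R.root m ∨ (p ∉ V ∧ G.HiddenPath V (R.root m) p)) :
    readAt p (R.embed z') m = z' m := by
  classical
  by_cases hpV : p ∈ V
  · have hp : p = R.root m := h.resolve_right fun h => h.1 hpV
    have hm : m = ⟨.inl p, inl_mem_functionalProjection.2 hpV⟩ :=
      Subtype.ext ((R.eq_inl (hp ▸ hpV)).trans (congrArg _ hp.symm))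
    rw [hm, readAt_of_mem (hV hpV) hpV, R.obsEquiv_embed z' (n := ⟨p, hV hpV⟩)]
  · have hp : p ∈ G.verts := by
      rcases h with rfl | ⟨_, h⟩
      · exact R.root_mem hV m
      · obtain ⟨q, hq, _⟩ := h.exists_last
        exact G.right_mem hq
    rw [readAt_of_notMem hp hpV, R.hidEquiv_embed z' (n := ⟨p, hp⟩) hpV, if_pos]
    exact h.imp Eq.symm And.right

theorem restrict_embed (hV : V ⊆ G.verts) (z' : (G.functionalProjection V W).Inst S') :
    R.restrict (R.embed z') = z' :=
  funext fun _ => R.readAt_embed hV z' (.inl rfl)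

open Classical in
theorem arriving_embed (hV : V ⊆ G.verts) (z' : (G.functionalProjection V W).Inst S') (n : N)
    (m : (G.functionalProjection V W).verts) : R.arriving n (R.embed z') m =
      if G.HiddenPath V (R.root m) n then z' m else defaultInst G V W S' m := by
  unfold arriving
  split_ifs with h
  · exact R.readAt_embed hV z' (R.par_spec _ _ h).2
  · rfl

theorem hiddenPath_root (hWV : Disjoint W V) {n : N} {m : (G.functionalProjection V W).verts}
    (h : (G.functionalProjection V W).Adj m (.inl n)) : G.HiddenPath V (R.root m) n := by
  obtain ⟨a | e, hm⟩ := m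
  · obtain ⟨ha, hn, h⟩ := h
    exact (CausalGraph.hiddenPath_elimSet hWV (Finset.disjoint_right.1 hWV ha)
      (Finset.disjoint_right.1 hWV hn)).1 h
  · exact (R.src_spec e h.1).2.2 n h.2

theorem simFactor_embed_of_mem (hV : V ⊆ G.verts) (hWV : Disjoint W V)
    (z' : (G.functionalProjection V W).Inst S') (n : G.verts) (h : (n : N) ∈ V) :
    R.simFactor M' n (R.embed z') =
      M'.factor ⟨.inl n, inl_mem_functionalProjection.2 h⟩ z' := by
  classical
  simp only [simFactor, dif_pos h, R.obsEquiv_embed]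
  refine M'.factor_congr _ _ _ (by simp) fun p hp => ?_
  rw [Function.update_of_ne]
  · rw [R.arriving_embed hV, if_pos (R.hiddenPath_root hWV hp)]
  · rintro rfl
    exact (G.functionalProjection V W).acyclic _ (.single hp)

open Classical in
theorem simFactor_embed_of_notMem (hV : V ⊆ G.verts)
    (z' : (G.functionalProjection V W).Inst S') (n : G.verts) (h : (n : N) ∉ V) :
    R.simFactor M' n (R.embed z') =
      ∏ m : (G.functionalProjection V W).verts, if R.root m = n then M'.factor m z' else 1 := by
  simp only [simFactor, dif_neg h, hidFactor]
  refine Finset.prod_congr rfl fun m _ => ?_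
  by_cases hm : R.root m = n
  · obtain ⟨e, he⟩ := R.exists_eq_inr (m := m) (by rwa [hm])
    rw [if_pos hm, if_pos hm]
    refine factor_inr_congr M' he ?_
    rw [R.hidEquiv_embed z' h, if_pos (.inl hm)]
  · rw [if_neg hm, if_neg hm, if_pos]
    rw [R.hidEquiv_embed z' h, R.arriving_embed hV]
    simp [hm]

-- Grouping the variables of the projection by their root, each factor of `M'` occurs once, at the
-- variable where its value originates.
open Classical in
theorem prod_simFactor_embed (hV : V ⊆ G.verts) (hWV : Disjoint W V) {X : Finset N} (hX : X ⊆ V)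
    (z' : (G.functionalProjection V W).Inst S') :
    ∏ n ∈ Finset.univ.filter (fun n : G.verts => (n : N) ∉ X), R.simFactor M' n (R.embed z') =
      ∏ m ∈ Finset.univ.filter (fun m : (G.functionalProjection V W).verts =>
        (m : N ⊕ Sym2 N) ∉ observed X), M'.factor m z' := by
  rw [Finset.prod_filter, Finset.prod_filter,
    ← Finset.prod_fiberwise (s := Finset.univ)
      (g := fun m : (G.functionalProjection V W).verts => (⟨R.root m, R.root_mem hV m⟩ : G.verts))]
  refine Finset.prod_congr rfl fun n _ => ?_
  by_cases h : (n : N) ∈ V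
  · have hfib : Finset.univ.filter (fun m : (G.functionalProjection V W).verts =>
        (⟨R.root m, R.root_mem hV m⟩ : G.verts) = n) =
        {⟨.inl n, inl_mem_functionalProjection.2 h⟩} := by
      ext m
      simp only [Finset.mem_filter, Finset.mem_univ, true_and, Finset.mem_singleton]
      constructor
      · rintro rfl
        exact Subtype.ext (R.eq_inl h)
      · rintro rfl
        rfl
    rw [hfib, Finset.prod_singleton, R.simFactor_embed_of_mem M' hV hWV z' n h]
    simp only [SignEquations.inl_mem_observed]
  · rw [if_pos (fun hn => h (hX hn)), R.simFactor_embed_of_notMem M' hV z' n h,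
      ← Finset.prod_filter]
    refine Finset.prod_congr ?_ fun m hm => ?_
    · ext m
      simp [Subtype.ext_iff]
    · have hroot : R.root m = n := congrArg Subtype.val (Finset.mem_filter.1 hm).2
      obtain ⟨e, he⟩ := R.exists_eq_inr (m := m) (by rwa [hroot])
      rw [if_pos (by rw [he]; exact SignEquations.inr_notMem_observed)]

/-- Nonzero hidden factors force every relayed component to be a faithful copy, so only
instantiations in the range of `embed` have weight. -/
theorem embed_restrict {z : G.Inst (SimState G V W S')}
    (hz : ∀ n : G.verts, (n : N) ∉ V → R.simFactor M' n z ≠ 0) :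
    R.embed (R.restrict z) = z := by
  classical
  have hacyc : ∀ a : G.verts,
      ¬ Relation.TransGen (Function.swap fun p n : G.verts => G.Adj p n) a a := fun a h =>
    BN.adj_verts_acyclic G a (Relation.transGen_swap.1 h)
  have key : ∀ (n : G.verts) (h : (n : N) ∉ V) (m : (G.functionalProjection V W).verts),
      hidEquiv h (z n) m = if R.root m = n ∨ G.HiddenPath V (R.root m) n then R.restrict z m
        else defaultInst G V W S' m := by
    by_contra! hbad
    set B : Finset G.verts := Finset.univ.filter fun n => ∃ (h : (n : N) ∉ V) (m : _),
      hidEquiv h (z n) m ≠ if R.root m = n ∨ G.HiddenPath V (R.root m) n then R.restrict z m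
        else defaultInst G V W S' m with hB
    have hne : B.Nonempty := by
      obtain ⟨n, h, m, hm⟩ := hbad
      exact ⟨n, Finset.mem_filter.2 ⟨Finset.mem_univ n, h, m, hm⟩⟩
    -- The relation is reversed: `n` is a bad variable none of whose parents is bad.
    obtain ⟨n, hnB, hn⟩ := exists_sink hacyc hne
    obtain ⟨-, h, m, hm⟩ := Finset.mem_filter.1 hnB
    apply hm
    by_cases hroot : R.root m = n
    · rw [if_pos (.inl hroot), restrict, hroot, readAt_of_notMem n.2 h]
    · have hfac := hz n h
      simp only [simFactor, dif_neg h] at hfac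
      have hfm := Finset.prod_ne_zero_iff.1 hfac m (Finset.mem_univ m)
      unfold hidFactor at hfm
      rw [if_neg hroot] at hfm
      have harr : hidEquiv h (z n) m = R.arriving n z m := by
        by_contra hne
        exact hfm (if_neg hne)
      rw [harr, arriving]
      by_cases hpath : G.HiddenPath V (R.root m) n
      · rw [if_pos hpath, if_pos (.inr hpath)]
        obtain ⟨hadj, hp | ⟨hpV, hp⟩⟩ := R.par_spec _ _ hpath
        · rw [hp, restrict]
        · have hpB : (⟨_, G.left_mem hadj⟩ : G.verts) ∉ B := fun hpB => hn _ hpB hadj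
          rw [readAt_of_notMem (G.left_mem hadj) hpV]
          by_contra hne
          refine hpB (Finset.mem_filter.2 ⟨Finset.mem_univ _, hpV, m, ?_⟩)
          rw [if_pos (.inr hp)]
          exact hne
      · rw [if_neg hpath, if_neg (by tauto)]
  funext n
  by_cases h : (n : N) ∈ V
  · rw [← (obsEquiv h).injective.eq_iff, R.obsEquiv_embed, restrict]
    exact readAt_of_mem n.2 h z
  · rw [← (hidEquiv h).injective.eq_iff]
    funext m
    rw [R.hidEquiv_embed, key]

/-- Agreement with the embedded instantiations is needed on `V` only, so the lemma also applies to
arbitrary instantiations of `G`, as in `prob_simBN`. -/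
theorem effect_simBN (hV : V ⊆ G.verts) (hWV : Disjoint W V) {X Y : Finset N} (hX : X ⊆ V)
    (hY : Y ⊆ V) {x y : G.Inst (SimState G V W S')}
    {x' y' : (G.functionalProjection V W).Inst S'}
    (hx : ∀ n : G.verts, (n : N) ∈ V → x n = R.embed x' n)
    (hy : ∀ n : G.verts, (n : N) ∈ V → y n = R.embed y' n) :
    (R.simBN M').effect X x Y y = M'.effect (observed X) x' (observed Y) y' := by
  classical
  have hagree : ∀ {A : Finset N}, A ⊆ V → ∀ {a : G.Inst (SimState G V W S')}
      {a' z' : (G.functionalProjection V W).Inst S'},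
      (∀ n : G.verts, (n : N) ∈ V → a n = R.embed a' n) →
      ((∀ n : G.verts, (n : N) ∈ A → R.embed z' n = a n) ↔
        ∀ m : (G.functionalProjection V W).verts, (m : N ⊕ Sym2 N) ∈ observed A →
          z' m = a' m) := by
    intro A hA a a' z' ha
    constructor
    · rintro h ⟨b | e, hm⟩ hmA
      · have hbA := SignEquations.inl_mem_observed.1 hmA
        have h1 := h ⟨b, hV (hA hbA)⟩ hbA
        rw [ha _ (hA hbA)] at h1
        have h2 := congrArg (obsEquiv (hA hbA)) h1
        rwa [R.obsEquiv_embed z' (n := ⟨b, hV (hA hbA)⟩),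
          R.obsEquiv_embed a' (n := ⟨b, hV (hA hbA)⟩)] at h2
      · exact absurd hmA SignEquations.inr_notMem_observed
    · intro h n hn
      rw [ha n (hA hn), ← (obsEquiv (hA hn)).injective.eq_iff, R.obsEquiv_embed,
        R.obsEquiv_embed]
      exact h _ (SignEquations.inl_mem_observed.2 hn)
  rw [BN.effect_eq_sum, BN.effect_eq_sum]
  symm
  -- Instantiations outside the range of `embed` contribute 0. Interventions on `X ⊆ V` keep all
  -- hidden factors, so this also holds after `do(x)`.
  refine Fintype.sum_of_injective R.embed
    (Function.LeftInverse.injective (R.restrict_embed hV)) _ _ ?_ ?_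
  · intro z hz
    rw [ite_eq_right_iff]
    intro _
    by_contra hne
    refine hz ⟨R.restrict z, R.embed_restrict M' fun n hn => ?_⟩
    have := Finset.prod_ne_zero_iff.1 hne n
      (Finset.mem_filter.2 ⟨Finset.mem_univ n, fun h => hn (hX h)⟩)
    rwa [factor_simBN] at this
  · intro z'
    refine if_congr (and_congr (hagree hY hy).symm (hagree hX hx).symm) ?_ rfl
    simp only [factor_simBN]
    exact (R.prod_simFactor_embed M' hV hWV hX z').symm

theorem prob_simBN (hV : V ⊆ G.verts) (hWV : Disjoint W V) (w : G.Inst (SimState G V W S')) :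
    (R.simBN M').prob V w = M'.prob (observed V) (R.restrict w) := by
  have hw : ∀ n : G.verts, (n : N) ∈ V → w n = R.embed (R.restrict w) n := by
    intro n h
    rw [← (obsEquiv h).injective.eq_iff, R.obsEquiv_embed, restrict]
    exact (readAt_of_mem n.2 h w).symm
  rw [← BN.effect_empty _ V w w,
    R.effect_simBN M' hV hWV (Finset.empty_subset V) (Finset.Subset.refl V) hw hw,
    ← BN.effect_empty M' (observed V) (R.restrict w)]
  simp [observed]

end RelayPlan

theorem identifiable_of_fIdentifiable {X Y : Finset N} (hV : V ⊆ G.verts) (hWV : Disjoint W V)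
    (hX : X ⊆ V) (hY : Y ⊆ V) (h : FIdentifiable G V {strictPositivity V} W X Y) :
    Identifiable (G.functionalProjection V W) (observed V) {strictPositivity (observed V)}
      (observed X) (observed Y) := by
  intro S' _ _ M₁ M₂ hprob hpos₁ hpos₂ x' y'
  rw [BN.satisfies_strictPositivity] at hpos₁ hpos₂
  -- The choice functions of a `RelayPlan` need default values in `N`; over an empty `N` all effects
  -- are 1.
  by_cases hN : Nonempty N
  · obtain ⟨R⟩ := RelayPlan.nonempty G hWV
    rw [← R.effect_simBN M₁ hV hWV hX hY (fun _ _ => rfl) (fun _ _ => rfl),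
      ← R.effect_simBN M₂ hV hWV hX hY (fun _ _ => rfl) (fun _ _ => rfl)]
    refine h _ _ _ (fun w => ?_) ?_ ?_ (R.functional_simBN M₁ hWV) (R.functional_simBN M₂ hWV) _ _
    · rw [R.prob_simBN M₁ hV hWV, R.prob_simBN M₂ hV hWV, hprob]
    · rw [BN.satisfies_strictPositivity]
      exact fun w => by rw [R.prob_simBN M₁ hV hWV]; exact hpos₁ _
    · rw [BN.satisfies_strictPositivity]
      exact fun w => by rw [R.prob_simBN M₂ hV hWV]; exact hpos₂ _
  · rw [not_nonempty_iff] at hN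
    have hY' : Y = ∅ := Finset.eq_empty_of_isEmpty Y
    have hV' : X = ∅ := Finset.eq_empty_of_isEmpty X
    subst hY' hV'
    have : observed (∅ : Finset N) = ∅ := rfl
    rw [this, BN.effect_empty, BN.effect_empty, BN.prob_empty, BN.prob_empty]

end Simulation

/-- Elimination of `W` preserves hidden paths between observed variables, so a hedge for `G` with
the bidirected edges of the projection is a hedge for the reduced graph, where it contradicts
identifiability. -/
theorem fIdentifiable_of_identifiable {N : Type u} [DecidableEq N] {G : CausalGraph N}
    {V W X Y : Finset N} (hWV : Disjoint W V) (hX : X ⊆ V) (hY : Y ⊆ V)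
    (h : Identifiable (G.functionalProjection V W) (observed V) {strictPositivity (observed V)}
      (observed X) (observed Y)) : FIdentifiable G V {strictPositivity V} W X Y := by
  intro S _ _ M₁ M₂ hprob hpos₁ _ hW₁ hW₂ x y
  rw [BN.satisfies_strictPositivity] at hpos₁
  have hVW : ∀ a ∈ V, a ∉ W := fun a ha => Finset.disjoint_right.1 hWV ha
  refine BN.effect_eq_of_no_hedge hW₁ hW₂ hX hY
    (bi := fun a b => s(a, b) ∈ (G.elimSet W).bidirected V)
    (fun a b hab => by rwa [Sym2.eq_swap]) ?_ ?_ hprob hpos₁ x y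
  · exact fun a ha b hb hab hh => (CausalGraph.mem_bidirected_elimSet hWV ha hb).2 ⟨hab, hh⟩
  · intro F D A hF
    refine not_identifiable_of_isHedge (H := G.elimSet W) (X := X) (Y := Y) (F := F) (D := D)
      (A := A) ⟨hF.F_subset, hF.D_subset, hF.D_nonempty, hF.F_connected, hF.D_connected, hF.meets,
        hF.A_subset, hF.A_avoids, hF.D_subset_A, ?_, ?_⟩ h
    · intro v hv hvD
      obtain ⟨w, hw, hvw⟩ := hF.child_F v hv hvD
      exact ⟨w, hw, (CausalGraph.hiddenPath_elimSet hWV (hVW v (hF.F_subset hv))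
        (hVW w (hF.F_subset hw))).2 hvw⟩
    · intro v hv hvY
      obtain ⟨w, hw, hvw⟩ := hF.child_A v hv hvY
      exact ⟨w, hw, (CausalGraph.hiddenPath_elimSet hWV (hVW v (hF.A_subset hv))
        (hVW w (hF.A_subset hw))).2 hvw⟩

end CausalID

open CausalID in
theorem mainTheorem7 {N : Type u} [DecidableEq N] (G : CausalGraph N)
    (V W X Y : Finset N) (hV : V ⊆ G.verts) (hW : W ⊆ G.verts) (hWV : Disjoint W V)
    (hX : X ⊆ V) (hY : Y ⊆ V) :
    FIdentifiable G V {strictPositivity V} W X Y ↔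
      Identifiable (G.functionalProjection V W) (observed V)
        {strictPositivity (observed V)} (observed X) (observed Y) :=
  ⟨identifiable_of_fIdentifiable hV hWV hX hY, fIdentifiable_of_identifiable hWV hX hY⟩
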